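/- **Setting.** All Pauli operators are taken up to phase. Let $Q$ be a qubit stabiliser code given by finitely many commuting checks $s_j$, with distance $d$: the minimal weight of a Pauli operator that commutes with all checks and is not a product of checks is $d$ (in particular such operators exist). Let $\Lambda_i$ ($i\in\mathcal I$) be logical operators of $Q$ (Paulis commuting with all checks) such that on every qubit $q$ any two of them act by the same letter or at least one of them acts trivially; write $P_q$ for the common nontrivial letter. (For $\overline Z$ logicals of a CSS code, $P_q=Z$.) Let $T$ be a binary tree whose leaves are labelled bijectively by $\mathcal I$. For a vertex $a$ of $T$ let $V_a$ be the union of the supports of the $\Lambda_i$ at leaves below $a$, and $C_a$ the set of $j$ such that $s_j$ locally anticommutes with $P_q$ at some $q\in V_a$; call $j$ and $q$ incident in that case. *Branched code.* For each non-root vertex $a$ add a qubit $(a,q)$ for each $q\in V_a$ and a qubit $(a,j)$ for each $j\in C_a$. The checks are: $\tilde s_j$, i.e. $s_j$ times $X$ on $(b,j)$ for the children $b$ of the root with $j\in C_b$; for each $a$ and $q\in V_a$ a check $A_{a,q}$ acting as $Z$ on $(a,q)$, as $Z$ on $(a',q)$ for the parent $a'$ of $a$ (as $P_q$ on $q$ if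 $a'$ is the root), and as $Z$ on all $(a,j)$ with $j$ incident to $q$; for each $a$ and $j\in C_a$ a check $B_{a,j}$ acting as $X$ on the $(a,q)$ with $q\in V_a$ incident to $j$, on $(a,j)$, and on $(b,j)$ for the children $b$ of $a$ with $j\in C_b$. The letters $Z,X$ on the new qubits may be replaced by any two anticommuting letters (for instance exchanged, as in the scheme for $\overline X$ logicals). *Branching* with $p$ and $r$ rounds: measure all $s_j$ in rounds $0,\dots,p-1$; initialise all new qubits in $|+\rangle$ (in general in an eigenstate of the letter replacing $X$) at the time of round $p-1$; measure all checks of the branched code in rounds $p,\dots,p+r-1$. *Un-branching* with $r$ and $m$ rounds: measure all checks of the branched code in rounds $0,\dots,r-1$; in round $r$ measure out every new qubit in the $X$ basis (the same basis); measure all $s_j$ in rounds $r,\dots,r+m-1$. *Faults.* A fault is a collection of single-qubit Pauli errors between consecutive rounds, on qubits present at that time, and of wrong signs of measurements, readouts and initialisations; its weight is the number of single-qubit errors plus the number of wrong signs. A detector is a set of initialisations and measurements whose product of signs is deterministic in the absence of faults, for every input. A fault is *undetected* if it violates no detector, and *trivial* (a spacetime stabiliser) if for every input it leaves the joint distribution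 of recorded signs and output state unchanged. The *fault-distance* is the minimal weight of an undetected, nontrivial fault, under the convention that the check measurements of the first and of the last round are perfect. **Lemma.** 1. For all $p\ge 1$ and $r\ge d$, branching has fault-distance exactly $d$. 2. For all $r\ge1$ and $m\ge1$ (in particular with a single round of measurement of the original checks), un-branching has fault-distance exactly $d$. 3. The convention of perfect rounds is justified by $d$ noisy rounds on each side: for branching with $p,r\ge d$, and for un-branching with $r,m\ge d$, where all rounds are noisy, every undetected fault of weight less than $d$ admits a round before and a round after the change of code, both without wrong check measurements, such that the part of the fault between these two rounds (with all initialisation and readout errors) is trivial. Here the round at whose time the initialisations take place counts as before, and the round of the readouts as after, the change of code. -/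

import Mathlib

namespace BruteBranch

open Finset

/-! ### Pauli operators and stabiliser codes (phases are dropped) -/

/-- A single-qubit Pauli operator up to phase, `(x, z)` standing for `X ^ x * Z ^ z`. -/
abbrev Letter := ZMod 2 × ZMod 2

/-- `0` if the two letters commute, `1` if they anticommute. -/
def Letter.symp (a b : Letter) : ZMod 2 := a.1 * b.2 + a.2 * b.1

/-- Pauli operators up to phase on the set of qubits `Ω`; multiplication of operators is `+`. -/
abbrev Pauli (Ω : Type*) := Ω → Letter

/-- `0` if the two Pauli operators commute, `1` if they anticommute. -/
def symp {Ω : Type*} [Fintype Ω] (P Q : Pauli Ω) : ZMod 2 := ∑ q, Letter.symp (P q) (Q q)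

/-- The nontrivial logical operators of the stabiliser code with the checks `s`: they commute with
all the checks and are not in the group that the checks generate. -/
def nontrivialLogicals {Ω J : Type*} [Fintype Ω] (s : J → Pauli Ω) : Set (Pauli Ω) :=
  {L | (∀ j, symp L (s j) = 0) ∧ L ∉ Submodule.span (ZMod 2) (Set.range s)}

/-- `d` is the distance of the code: the minimal Pauli weight of a nontrivial logical operator. -/
def IsCodeDistance {Ω J : Type*} [Fintype Ω] (s : J → Pauli Ω) (d : ℕ) : Prop :=
  IsLeast ((fun L => hammingNorm L) '' nontrivialLogicals s) d

/-! ### Binary trees that split a set of logical operators -/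

/-- Binary trees with leaves labelled by (indices of) logical operators. -/
inductive SplitTree (ι : Type*) where
  | leaf (i : ι) : SplitTree ι
  | node (l r : SplitTree ι) : SplitTree ι

namespace SplitTree

variable {ι : Type*}

/-- The labels of the leaves. -/
def leaves : SplitTree ι → List ι
  | leaf i => [i]
  | node l r => l.leaves ++ r.leaves

/-- The addresses of all vertices of the tree, as paths that start at the root `[]`. The parent of
a vertex `a` other than the root is `a.dropLast`. -/
def nodes : SplitTree ι → Finset (List Bool)
  | leaf _ => {[]}
  | node l r => insert [] (l.nodes.image (List.cons false) ∪ r.nodes.image (List.cons true))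

/-- The labels of the leaves at or below the vertex with the given address. -/
def labels : SplitTree ι → List Bool → List ι
  | t, [] => t.leaves
  | leaf _, _ :: _ => []
  | node l _, false :: a => l.labels a
  | node _ r, true :: a => r.labels a

end SplitTree

/-! ### Brute-force branching -/

/-- The input of brute-force branching: a stabiliser code with qubits `n` and checks `J`, a family
of logical operators that on each qubit use at most one non-identity Pauli letter, and a binary
tree that has each of these logical operators at exactly one leaf. The new qubits use two
anticommuting letters: the copies of the logical operators are products of `copyL`, and the new
qubits are initialised and measured out in the eigenbasis of `transL`. Branching of `Z` logicals
of a CSS code, with ancillas in `|+⟩`, has `copyL = Z`, `transL = X`; the dual scheme for `X`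
logicals, with ancillas in `|0⟩`, has `copyL = X`, `transL = Z`. -/
structure Branching (n J ι : Type*) [Fintype n] where
  check : J → Pauli n
  check_comm : ∀ i j, symp (check i) (check j) = 0
  logical : ι → Pauli n
  logical_comm : ∀ i j, symp (logical i) (check j) = 0
  compatible : ∀ i i' q, logical i q = logical i' q ∨ logical i q = 0 ∨ logical i' q = 0
  tree : SplitTree ι
  leaves_nodup : tree.leaves.Nodup
  mem_leaves : ∀ i, i ∈ tree.leaves
  copyL : Letter
  transL : Letter
  letters_anticomm : Letter.symp copyL transL = 1

namespace Branching

variable {n J ι : Type*} [Fintype n] [Fintype J] [DecidableEq n] [DecidableEq J]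
variable (B : Branching n J ι)

/-- The non-identity letter by which logical operators act on the qubit `q` (identity if none
of them acts on `q`). -/
def letter (q : n) : Letter :=
  ((B.tree.leaves.map (fun i => B.logical i q)).find? (fun a => decide (a ≠ 0))).getD 0

/-- The matrix entry of the local classical code: the check `j` anticommutes on the qubit `q` with
the logical operators that act there. -/
def Incident (j : J) (q : n) : Prop := Letter.symp (B.check j q) (B.letter q) = 1

instance (j : J) (q : n) : Decidable (B.Incident j q) :=
  inferInstanceAs (Decidable (Letter.symp (B.check j q) (B.letter q) = 1))

/-- The union of the supports of the logical operators that belong to the tree vertex `a`. -/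
def bits (a : List Bool) : Finset n :=
  univ.filter fun q => ∃ i ∈ B.tree.labels a, B.logical i q ≠ 0

/-- The checks that are incident to that union. -/
def incidentChecks (a : List Bool) : Finset J :=
  univ.filter fun j => ∃ q ∈ B.bits a, B.Incident j q

/-- The branches, one for each vertex of the tree other than the root. -/
abbrev Branch : Type := {a : List Bool // a ∈ B.tree.nodes.erase []}

/-- Pairs of a branch and a bit of its classical code. They index the new data qubits in the second
layer of the branch, and the new vertex checks (`A_v`) in its first layer. -/
abbrev BitSite : Type _ := {x : B.Branch × n // x.2 ∈ B.bits x.1.1}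

/-- Pairs of a branch and a check of its classical code. They index the new data qubits in the first
layer of the branch, and the new face checks (`B_p`) in its second layer. -/
abbrev CheckSite : Type _ := {x : B.Branch × J // x.2 ∈ B.incidentChecks x.1.1}

/-- The new data qubits. -/
abbrev Anc : Type _ := B.BitSite ⊕ B.CheckSite

/-- All data qubits of the branched code. -/
abbrev Qubit : Type _ := n ⊕ B.Anc

/-- A check of the original code. -/
def oldOp (j : J) : Pauli B.Qubit
  | .inl q => B.check j q
  | .inr _ => 0

/-- A check of the original code, deformed by the stickers that are attached to the root. -/
def deformedOp (j : J) : Pauli B.Qubit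
  | .inl q => B.check j q
  | .inr (.inl _) => 0
  | .inr (.inr c) => if c.1.2 = j ∧ c.1.1.1.dropLast = [] then B.transL else 0

/-- The new check at a bit `q` in the first layer of a branch `a`. It acts on the bit `q` of the
parent of `a` (which is the qubit `q` of the original code if the parent is the root), on the
bit `q` in the second layer of `a`, and on the first-layer qubits of `a` that belong to checks
incident to `q`. -/
def vertexOp (v : B.BitSite) : Pauli B.Qubit
  | .inl q => if v.1.1.1.dropLast = [] ∧ q = v.1.2 then B.letter q else 0
  | .inr (.inl b) =>
      if b.1.2 = v.1.2 ∧ (b.1.1.1 = v.1.1.1 ∨ b.1.1.1 = v.1.1.1.dropLast) then B.copyL else 0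
  | .inr (.inr c) => if c.1.1.1 = v.1.1.1 ∧ B.Incident c.1.2 v.1.2 then B.copyL else 0

/-- The new check that copies the check `j` in the second layer of a branch `a`. It acts on the
second-layer qubits of `a` incident to `j`, on the first-layer qubit `j` of `a`, and on the
first-layer qubits `j` of the children of `a`. -/
def faceOp (p : B.CheckSite) : Pauli B.Qubit
  | .inl _ => 0
  | .inr (.inl b) => if b.1.1.1 = p.1.1.1 ∧ B.Incident p.1.2 b.1.2 then B.transL else 0
  | .inr (.inr c) =>
      if c.1.2 = p.1.2 ∧ (c.1.1.1 = p.1.1.1 ∨ c.1.1.1.dropLast = p.1.1.1) then B.transL else 0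

/-- Labels of the checks of the branched code: deformed, vertex and face checks. -/
abbrev NewCheck : Type _ := J ⊕ (B.BitSite ⊕ B.CheckSite)

/-- The checks of the branched code. -/
def newOp : B.NewCheck → Pauli B.Qubit
  | .inl j => B.deformedOp j
  | .inr (.inl v) => B.vertexOp v
  | .inr (.inr p) => B.faceOp p

/-- The letter `transL` on one new qubit. -/
def ancOp (e : B.Anc) : Pauli B.Qubit
  | .inl _ => 0
  | .inr e' => if e' = e then B.transL else 0

end Branching

/-! ### Procedures made of initialisations and Pauli measurements -/

/-- A procedure on the qubits `Ω`, with the finite set `E` of events. An event is a measurement of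
the Pauli operator `op`, or an initialisation in an eigenstate of `op`; the latter is treated as a
measurement of `op` on a qubit that before was not part of the system. The event `e` takes place at
the half-integer time `time e + 1/2`, which lies in one of the rounds `0, …, rounds - 1`; events
in one round commute. `isCheck` marks the measurements of checks, as opposed to initialisations
and readouts of single qubits, and `present t q` says that the qubit `q` exists at the integer
time `t`; the input is at time `0` and the output at time `rounds`. -/
structure Procedure (Ω E : Type*) where
  rounds : ℕ
  time : E → ℕ
  op : E → Pauli Ω
  isCheck : E → Prop
  present : ℕ → Ω → Prop

/-- A spacetime fault: Pauli errors at the integer times, and events (measurement or initialisation)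
whose sign is wrong. -/
structure Fault (Ω E : Type*) where
  space : ℕ → Pauli Ω
  flip : E → ZMod 2

namespace Procedure

variable {Ω E : Type*} [Fintype Ω] [Fintype E] (P : Procedure Ω E)

/-- The product of the signs of the events in `D` and of the output operator `L`, pulled back to the
integer time `t` (Heisenberg picture): `L` times all operators of `D` after time `t`. -/
def pullback (D : Finset E) (L : Pauli Ω) (t : ℕ) : Pauli Ω :=
  L + ∑ e ∈ D with t ≤ P.time e, P.op e

/-- The product of the signs of the events in `D` and of the output operator `L` is not randomised
by any event: the pulled-back operator commutes with every event that it passes, and involves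
only qubits that exist. Then, in the absence of faults, this product has the same expectation as
the operator `P.pullback D L 0` on the input. For all other pairs `(D, L)` the expectation
vanishes for every input. -/
def IsCorrelation (D : Finset E) (L : Pauli Ω) : Prop :=
  (∀ e, symp (P.pullback D L (P.time e + 1)) (P.op e) = 0) ∧
  ∀ t ≤ P.rounds, ∀ q, ¬ P.present t q → P.pullback D L t q = 0

/-- A detector: a collection of initialisations and measurements such that the product of their
signs is deterministic in the absence of faults. -/
def IsDetector (D : Finset E) : Prop :=
  P.IsCorrelation D 0 ∧ P.pullback D 0 0 = 0

/-- Whether (`1`) or not (`0`) the fault `F` inverts the product of the signs of the events in `D`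
and of the output operator `L`. -/
def inversion (D : Finset E) (L : Pauli Ω) (F : Fault Ω E) : ZMod 2 :=
  ∑ e ∈ D, F.flip e + ∑ t ∈ range P.rounds, symp (F.space t) (P.pullback D L t)

/-- Pauli errors occur between the rounds, on qubits that exist at that time. -/
def IsFault (F : Fault Ω E) : Prop :=
  ∀ t q, F.space t q ≠ 0 → 0 < t ∧ t < P.rounds ∧ P.present t q

/-- The weight of a fault: the number of single-qubit Pauli errors plus the number of events whose
sign is wrong. -/
def weight (F : Fault Ω E) : ℕ :=
  ∑ t ∈ range P.rounds, hammingNorm (F.space t) + hammingNorm F.flip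

/-- A spacetime logical fault violates no detector. -/
def IsUndetected (F : Fault Ω E) : Prop :=
  ∀ D, P.IsDetector D → P.inversion D 0 F = 0

/-- A spacetime stabiliser: for every input, the fault changes neither the statistics of the
detectors nor the result of the procedure (the joint distribution of recorded signs and output
state). -/
def IsStabiliser (F : Fault Ω E) : Prop :=
  ∀ D L, P.IsCorrelation D L → P.inversion D L F = 0

/-- There is no wrong check measurement in round `k`. -/
def PerfectRound (F : Fault Ω E) (k : ℕ) : Prop :=
  ∀ e, P.isCheck e → P.time e = k → F.flip e = 0

/-- `d` is the fault-distance, with the convention that the measurements of checks in the initial and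
in the final round are perfect. -/
def IsFaultDistance (d : ℕ) : Prop :=
  IsLeast (P.weight '' {F | P.IsFault F ∧ P.PerfectRound F 0 ∧ P.PerfectRound F (P.rounds - 1) ∧
    P.IsUndetected F ∧ ¬ P.IsStabiliser F}) d

open Classical in
/-- The part of a fault that lies strictly between the rounds `a` and `b`, together with all
initialisation and readout errors. -/
noncomputable def window (F : Fault Ω E) (a b : ℕ) : Fault Ω E where
  space t := if a < t ∧ t ≤ b then F.space t else 0
  flip e := if P.isCheck e → a < P.time e ∧ P.time e < b then F.flip e else 0

/-- Fault-tolerance up to weight `d` of a procedure that deforms the code at time `t`, without any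
perfect round: for every spacetime logical fault of weight less than `d` there are a round
before and a round after the deformation without wrong check measurements such that the part of
the fault between these rounds is a spacetime stabiliser. -/
def ToleratesPadded (t d : ℕ) : Prop :=
  ∀ F, P.IsFault F → P.IsUndetected F → P.weight F < d →
    ∃ a b, a < t ∧ t ≤ b ∧ b < P.rounds ∧ P.PerfectRound F a ∧ P.PerfectRound F b ∧
      P.IsStabiliser (P.window F a b)

end Procedure

namespace Branching

variable {n J ι : Type*} [Fintype n] [Fintype J] [DecidableEq n] [DecidableEq J]
variable (B : Branching n J ι)

/-- Branching at time `p`: `p` rounds in which the original checks are measured, initialisation of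
the new qubits at time `p - 1/2`, then `r` rounds in which the checks of the branched code are
measured, the first of them at time `p + 1/2`. -/
def branchProcedure (p r : ℕ) :
    Procedure B.Qubit ((Fin p × J) ⊕ B.Anc ⊕ (Fin r × B.NewCheck)) where
  rounds := p + r
  time
    | .inl (k, _) => k
    | .inr (.inl _) => p - 1
    | .inr (.inr (k, _)) => p + k
  op
    | .inl (_, j) => B.oldOp j
    | .inr (.inl e) => B.ancOp e
    | .inr (.inr (_, c)) => B.newOp c
  isCheck
    | .inr (.inl _) => False
    | _ => True
  present t
    | .inl _ => True
    | .inr _ => p ≤ t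

/-- Un-branching at time `r`: `r` rounds in which the checks of the branched code are measured, then,
at time `r + 1/2`, all new qubits are measured out and the original checks are measured; the
original checks are measured for `m` rounds in total. -/
def unbranchProcedure (r m : ℕ) :
    Procedure B.Qubit ((Fin r × B.NewCheck) ⊕ B.Anc ⊕ (Fin m × J)) where
  rounds := r + m
  time
    | .inl (k, _) => k
    | .inr (.inl _) => r
    | .inr (.inr (k, _)) => r + k
  op
    | .inl (_, c) => B.newOp c
    | .inr (.inl e) => B.ancOp e
    | .inr (.inr (_, j)) => B.oldOp j
  isCheck
    | .inr (.inl _) => False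
    | _ => True
  present t
    | .inl _ => True
    | .inr _ => t ≤ r

end Branching

end BruteBranch

/-!
Branching and un-branching are handled together, as procedures that change between the original and
the branched code (`Branching.IsCodeChange`); they are mirror images of each other in time.

*Algebra of the branched code.* An operator of the original code extends to the branched code by
letters `transL` on copies of bits (`Branching.extend`), in such a way that the vertex checks are
respected. The adjoint `Branching.collapse` of this map moves every error on a copy of a qubit `q`
back to `q`, so it does not increase weights. The decisive fact is `Branching.mem_span_newOp`: an
operator made of original checks and letters `transL` on new qubits is a product of checks of the
branched code as soon as it commutes with the vertex checks. It reduces to `mem_span_faceOp`, where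
the exponents of the face checks are found going down the tree. In particular the extension of an
original check is a product of checks of the branched code.

*Fault-distance.* Each logical operator `M` of the original code gives a canonical correlation of
the procedure, `M` on the one side and its extension on the other, joined by initialisations or
readouts. A fault inverts it according to the commutation of `extend M` with the product of all its
errors, wrong signs of initialisations and readouts included (`inversion_ancEvents`); wrong check
measurements do not enter. Every other correlation differs from a canonical one by a correlation
between products of checks of the first and of the last round. The measurements in these rounds
complete the latter to a detector (`IsCorrelation.inversion_eq_zero`), so that an undetected fault
does not invert it. For the same reason the product of all errors commutes with the extended checks,
so its collapse is a logical operator of the original code. If the fault has weight less than `d`,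
this logical operator is a product of checks, and the fault is trivial. A logical operator of
weight `d` at the time of the change of code shows that the bound is attained. With the outer
rounds perfect, one round of the branched code is enough in both directions.

*Noisy outer rounds.* If the fault has weight less than `d`, one of `d` rounds on each side has no
wrong check measurement. A detector of the whole procedure can be truncated to the part between two
such rounds, so this part of the fault is still undetected (`IsUndetected.window`), and the
previous argument applies to it.
-/

set_option linter.unusedSectionVars false

namespace BruteBranch

open Finset

/-! ### The symplectic form -/

section Symplectic

variable {Ω J : Type*} [Fintype Ω]

/-- The commutation form on Pauli operators as a bilinear map. -/
def sympForm : Pauli Ω →ₗ[ZMod 2] Pauli Ω →ₗ[ZMod 2] ZMod 2 :=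
  LinearMap.mk₂ (ZMod 2) symp
    (fun a b c => by
      simp only [symp, Letter.symp, ← sum_add_distrib, Pi.add_apply, Prod.fst_add, Prod.snd_add]
      exact sum_congr rfl fun _ _ => by ring)
    (fun r a b => by
      simp only [symp, Letter.symp, mul_sum, Pi.smul_apply, Prod.smul_fst, Prod.smul_snd,
        smul_eq_mul]
      exact sum_congr rfl fun _ _ => by ring)
    (fun a b c => by
      simp only [symp, Letter.symp, ← sum_add_distrib, Pi.add_apply, Prod.fst_add, Prod.snd_add]
      exact sum_congr rfl fun _ _ => by ring)
    (fun r a b => by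
      simp only [symp, Letter.symp, mul_sum, Pi.smul_apply, Prod.smul_fst, Prod.smul_snd,
        smul_eq_mul]
      exact sum_congr rfl fun _ _ => by ring)

theorem sympForm_apply (P Q : Pauli Ω) : sympForm P Q = symp P Q := rfl

theorem Letter.symp_comm (a b : Letter) : Letter.symp a b = Letter.symp b a := by
  simp only [Letter.symp]; ring

theorem Letter.symp_add (a b c : Letter) :
    Letter.symp (a + b) c = Letter.symp a c + Letter.symp b c := by
  simp only [Letter.symp, Prod.fst_add, Prod.snd_add]; ring

theorem Letter.symp_smul (r : ZMod 2) (a c : Letter) :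
    Letter.symp (r • a) c = r * Letter.symp a c := by
  simp only [Letter.symp, Prod.smul_fst, Prod.smul_snd, smul_eq_mul]; ring

theorem Letter.symp_self (a : Letter) : Letter.symp a a = 0 := by
  revert a; decide

@[simp] theorem Letter.symp_zero (a : Letter) : Letter.symp a 0 = 0 := by simp [Letter.symp]

@[simp] theorem Letter.zero_symp (a : Letter) : Letter.symp 0 a = 0 := by simp [Letter.symp]

theorem symp_comm (P Q : Pauli Ω) : symp P Q = symp Q P :=
  sum_congr rfl fun _ _ => Letter.symp_comm _ _

theorem symp_add_left (P Q R : Pauli Ω) : symp (P + Q) R = symp P R + symp Q R := by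
  simp [← sympForm_apply]

theorem symp_add_right (P Q R : Pauli Ω) : symp P (Q + R) = symp P Q + symp P R := by
  simp [← sympForm_apply]

@[simp] theorem symp_zero_left (P : Pauli Ω) : symp 0 P = 0 := by simp [← sympForm_apply]

@[simp] theorem symp_zero_right (P : Pauli Ω) : symp P 0 = 0 := by simp [← sympForm_apply]

theorem symp_sum_left {K : Type*} (s : Finset K) (f : K → Pauli Ω) (R : Pauli Ω) :
    symp (∑ k ∈ s, f k) R = ∑ k ∈ s, symp (f k) R := by
  simp [← sympForm_apply]

theorem symp_sum_right {K : Type*} (s : Finset K) (f : K → Pauli Ω) (R : Pauli Ω) :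
    symp R (∑ k ∈ s, f k) = ∑ k ∈ s, symp R (f k) := by
  simp [← sympForm_apply]

theorem symp_eq_zero_of_mem_span {S : Set (Pauli Ω)} {L x : Pauli Ω}
    (h : ∀ y ∈ S, symp L y = 0) (hx : x ∈ Submodule.span (ZMod 2) S) : symp L x = 0 := by
  have : Submodule.span (ZMod 2) S ≤ LinearMap.ker (sympForm L) :=
    Submodule.span_le.2 fun y hy => h y hy
  exact this hx

/-- A Pauli operator outside of the group generated by the checks anticommutes with some operator
that commutes with all the checks, because the commutation form is nondegenerate. -/
theorem exists_symp_eq_one_of_notMem_span {s : J → Pauli Ω} {L : Pauli Ω}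
    (hL : L ∉ Submodule.span (ZMod 2) (Set.range s)) :
    ∃ M, (∀ j, symp M (s j) = 0) ∧ symp L M = 1 := by
  classical
  obtain ⟨f, hfL, hf⟩ := Submodule.exists_dual_map_eq_bot_of_notMem hL inferInstance
  let M : Pauli Ω := fun q => (f (Pi.single q (0, 1)), f (Pi.single q (1, 0)))
  have key : ∀ x, symp x M = f x := by
    intro x
    have hx : x = ∑ q, (x q).1 • Pi.single q ((1, 0) : Letter)
        + ∑ q, (x q).2 • Pi.single q ((0, 1) : Letter) := by
      rw [← sum_add_distrib]
      conv_lhs => rw [← univ_sum_single x]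
      refine sum_congr rfl fun q _ => ?_
      rw [← Pi.single_smul, ← Pi.single_smul, ← Pi.single_add]
      congr 1
      ext <;> simp
    conv_rhs => rw [hx]
    rw [map_add, map_sum, map_sum, ← sum_add_distrib]
    refine sum_congr rfl fun q _ => ?_
    simp [Letter.symp, M]
  refine ⟨M, fun j => ?_, ?_⟩
  · rw [symp_comm, key]
    have : f (s j) ∈ (Submodule.span (ZMod 2) (Set.range s)).map f :=
      Submodule.mem_map_of_mem (Submodule.subset_span ⟨j, rfl⟩)
    rwa [hf, Submodule.mem_bot] at this
  · rw [key]
    generalize f L = c at hfL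
    revert c; decide

end Symplectic

/-! ### Weights -/

theorem hammingNorm_add_le {Ω : Type*} [Fintype Ω] (x y : Pauli Ω) :
    hammingNorm (x + y) ≤ hammingNorm x + hammingNorm y := by
  have h := hammingDist_triangle (-x) 0 y
  simpa [hammingDist_eq_hammingNorm] using h

theorem hammingNorm_sum_le {Ω K : Type*} [Fintype Ω] (s : Finset K) (x : K → Pauli Ω) :
    hammingNorm (∑ k ∈ s, x k) ≤ ∑ k ∈ s, hammingNorm (x k) := by
  classical
  induction s using Finset.induction_on with
  | empty => simp
  | insert k s hk ih =>
    rw [sum_insert hk, sum_insert hk]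
    exact (hammingNorm_add_le _ _).trans (by omega)

/-- The identity is a product of checks, so nontrivial logical operators have positive weight. -/
theorem IsCodeDistance.pos {Ω J : Type*} [Fintype Ω] {s : J → Pauli Ω} {d : ℕ}
    (hd : IsCodeDistance s d) : 1 ≤ d := by
  obtain ⟨L, hL, rfl⟩ := hd.1
  refine Nat.one_le_iff_ne_zero.2 fun h => hL.2 ?_
  rw [hammingNorm_eq_zero.1 h]
  exact Submodule.zero_mem _

/-! ### Sums over symmetric differences -/

theorem sum_symmDiff {E M : Type*} [DecidableEq E] [AddCommGroup M] [Module (ZMod 2) M]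
    (A C : Finset E) (f : E → M) :
    ∑ e ∈ symmDiff A C, f e = ∑ e ∈ A, f e + ∑ e ∈ C, f e := by
  rw [← sum_inter_add_sum_sdiff A C f, ← sum_inter_add_sum_sdiff C A f, inter_comm C A]
  have h : symmDiff A C = (A \ C) ∪ (C \ A) := rfl
  rw [h, sum_union disjoint_sdiff_sdiff, add_add_add_comm, ZModModule.add_self, zero_add]

theorem filter_symmDiff_eq {E : Type*} [DecidableEq E] (A C : Finset E) (p : E → Prop)
    [DecidablePred p] : (symmDiff A C).filter p = symmDiff (A.filter p) (C.filter p) := by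
  ext e
  simp only [mem_filter, mem_symmDiff]
  tauto

/-- Over the field with two elements, a member of a span is a sum without repetitions. -/
theorem exists_sum_eq_of_mem_span {E M : Type*} [AddCommGroup M] [Module (ZMod 2) M]
    {f : E → M} {A : Set E} {x : M} (hx : x ∈ Submodule.span (ZMod 2) (f '' A)) :
    ∃ D : Finset E, (∀ e ∈ D, e ∈ A) ∧ ∑ e ∈ D, f e = x := by
  classical
  induction hx using Submodule.span_induction with
  | mem x hx =>
    obtain ⟨e, he, rfl⟩ := hx
    exact ⟨{e}, by simpa using he, by simp⟩
  | zero => exact ⟨∅, by simp, by simp⟩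
  | add x y _ _ hx hy =>
    obtain ⟨D, hD, rfl⟩ := hx
    obtain ⟨C, hC, rfl⟩ := hy
    refine ⟨symmDiff D C, fun e he => ?_, sum_symmDiff D C f⟩
    rcases mem_symmDiff.1 he with h | h
    exacts [hD e h.1, hC e h.1]
  | smul a x _ hx =>
    obtain ⟨D, hD, rfl⟩ := hx
    obtain rfl | rfl : a = 0 ∨ a = 1 := by revert a; decide
    · exact ⟨∅, by simp, by simp⟩
    · exact ⟨D, hD, by simp⟩

/-! ### Correlations of a procedure -/

namespace Procedure

variable {Ω E : Type*}

/-- The group generated by the checks that are measured in round `k`. -/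
def checkGroup (P : Procedure Ω E) (k : ℕ) : Submodule (ZMod 2) (Pauli Ω) :=
  Submodule.span (ZMod 2) (P.op '' {e | P.isCheck e ∧ P.time e = k})

theorem pullback_symmDiff (P : Procedure Ω E) [DecidableEq E] (D D' : Finset E)
    (L L' : Pauli Ω) (t : ℕ) :
    P.pullback (symmDiff D D') (L + L') t = P.pullback D L t + P.pullback D' L' t := by
  simp only [pullback, filter_symmDiff_eq, sum_symmDiff]
  abel

theorem pullback_symmDiff_zero (P : Procedure Ω E) [DecidableEq E] (D D' : Finset E) (t : ℕ) :
    P.pullback (symmDiff D D') 0 t = P.pullback D 0 t + P.pullback D' 0 t := by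
  simpa using P.pullback_symmDiff D D' 0 0 t

theorem pullback_eq_add (P : Procedure Ω E) (D : Finset E) (L : Pauli Ω) (t : ℕ) :
    P.pullback D L t = L + P.pullback D 0 t := by
  simp [pullback]

variable {P : Procedure Ω E}

/-- The pulled-back product of events that all belong to the round `k`. -/
theorem pullback_of_time_eq {D : Finset E} {k : ℕ} (hD : ∀ e ∈ D, P.time e = k) (t : ℕ) :
    P.pullback D 0 t = if t ≤ k then ∑ e ∈ D, P.op e else 0 := by
  rw [pullback, zero_add]
  split_ifs with h
  · rw [filter_true_of_mem fun e he => (hD e he).symm ▸ h]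
  · rw [filter_false_of_mem fun e he => (hD e he).symm ▸ h, sum_empty]

/-- A product of checks of the round `k`, realised by measurements whose signs a fault that leaves
the round perfect does not invert. -/
theorem exists_checks {k : ℕ} {x : Pauli Ω} (hx : x ∈ P.checkGroup k) :
    ∃ D : Finset E, (∀ F : Fault Ω E, P.PerfectRound F k → ∑ e ∈ D, F.flip e = 0) ∧
      ∀ t, P.pullback D 0 t = if t ≤ k then x else 0 := by
  obtain ⟨D, hD, rfl⟩ := exists_sum_eq_of_mem_span hx
  exact ⟨D, fun F hF => sum_eq_zero fun e he => hF e (hD e he).1 (hD e he).2,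
    pullback_of_time_eq fun e he => (hD e he).2⟩

variable [Fintype Ω]

theorem inversion_symmDiff (P : Procedure Ω E) [DecidableEq E] (D D' : Finset E)
    (L L' : Pauli Ω) (F : Fault Ω E) :
    P.inversion (symmDiff D D') (L + L') F = P.inversion D L F + P.inversion D' L' F := by
  simp only [inversion, sum_symmDiff, pullback_symmDiff, symp_add_right, sum_add_distrib]
  abel

theorem IsCorrelation.symmDiff [DecidableEq E] {D D' : Finset E} {L L' : Pauli Ω}
    (h : P.IsCorrelation D L) (h' : P.IsCorrelation D' L') :
    P.IsCorrelation (symmDiff D D') (L + L') := by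
  constructor
  · intro e
    rw [pullback_symmDiff, symp_add_left, h.1, h'.1, add_zero]
  · intro t ht q hq
    rw [pullback_symmDiff, Pi.add_apply, h.2 t ht q hq, h'.2 t ht q hq, add_zero]

/-- A correlation between products of checks of the initial and of the final round is completed by
measurements in these two rounds to a detector. When these are perfect, an undetected fault
cannot invert the correlation. -/
theorem IsCorrelation.inversion_eq_zero {D : Finset E} {L : Pauli Ω} {F : Fault Ω E}
    (hc : P.IsCorrelation D L) (hT : 2 ≤ P.rounds) (htime : ∀ e, P.time e < P.rounds)
    (hF : P.IsFault F) (h0 : P.PerfectRound F 0)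
    (h1 : P.PerfectRound F (P.rounds - 1)) (hu : P.IsUndetected F)
    (hin : P.pullback D L 0 ∈ P.checkGroup 0) (hout : L ∈ P.checkGroup (P.rounds - 1)) :
    P.inversion D L F = 0 := by
  classical
  obtain ⟨A, hA, hA'⟩ := exists_checks hin
  obtain ⟨C, hC, hC'⟩ := exists_checks hout
  have hpull : ∀ t, P.pullback (_root_.symmDiff D (_root_.symmDiff A C)) 0 t =
      if 0 < t ∧ t < P.rounds then P.pullback D L t else 0 := by
    intro t
    have hL := P.pullback_eq_add D L t
    have h2 : P.pullback D 0 t = L + P.pullback D L t := by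
      rw [hL, ← add_assoc, ZModModule.add_self, zero_add]
    rw [pullback_symmDiff_zero, pullback_symmDiff_zero, hA', hC', h2]
    rcases Nat.eq_zero_or_pos t with rfl | ht
    · simp only [le_refl, if_true, Nat.zero_le, lt_irrefl, false_and, if_false]
      rw [← ZModModule.add_self (L + P.pullback D L 0)]
      abel
    · rw [if_neg (by omega)]
      by_cases ht' : t < P.rounds
      · rw [if_pos (by omega), if_pos ⟨ht, ht'⟩, zero_add, add_right_comm, ZModModule.add_self,
          zero_add]
      · rw [if_neg (by omega), if_neg (by omega), add_zero, add_zero, hL, pullback,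
          filter_false_of_mem (fun e _ => by have := htime e; omega)]
        rw [sum_empty, add_zero, add_zero, ZModModule.add_self]
  have hdet : P.IsDetector (_root_.symmDiff D (_root_.symmDiff A C)) := by
    refine ⟨⟨fun e => ?_, fun t ht q hq => ?_⟩, by simp [hpull]⟩
    · rw [hpull]
      split_ifs
      exacts [hc.1 e, symp_zero_left _]
    · rw [hpull]
      split_ifs
      exacts [hc.2 t ht q hq, rfl]
  rw [← hu _ hdet, inversion, inversion, sum_symmDiff, sum_symmDiff, hA F h0, hC F h1, add_zero,
    add_zero]
  congr 1
  refine sum_congr rfl fun t ht => ?_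
  rw [hpull]
  split_ifs with h
  · rfl
  · have : F.space t = 0 := by
      ext1 q
      by_contra hne
      exact h ⟨(hF t q hne).1, (hF t q hne).2.1⟩
    rw [this, symp_zero_left, symp_zero_left]

/-- The part of an undetected fault between two rounds without wrong check measurements is
undetected, provided that the changes of the code happen between these rounds: a detector can be
truncated to these rounds, its earlier and later check measurements being replaced by
measurements of the same product of checks in the two rounds. -/
theorem IsUndetected.window {F : Fault Ω E} {a b : ℕ} (hu : P.IsUndetected F) (hab : a < b)
    (ha' : P.PerfectRound F a) (hb' : P.PerfectRound F b)
    (hbefore : ∀ e, P.isCheck e → P.time e ≤ a → P.op e ∈ P.checkGroup a)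
    (hafter : ∀ e, P.isCheck e → b ≤ P.time e → P.op e ∈ P.checkGroup b)
    (hchange : ∀ e, ¬ P.isCheck e → a ≤ P.time e ∧ P.time e ≤ b) :
    P.IsUndetected (P.window F a b) := by
  classical
  intro D hD
  obtain ⟨A, hA, hA'⟩ := exists_checks (P := P) (k := a)
    (x := ∑ e ∈ D with P.isCheck e ∧ P.time e ≤ a, P.op e)
    (Submodule.sum_mem _ fun e he => hbefore e (mem_filter.1 he).2.1 (mem_filter.1 he).2.2)
  obtain ⟨C, hC, hC'⟩ := exists_checks (P := P) (k := b)
    (x := ∑ e ∈ D with P.isCheck e ∧ b ≤ P.time e, P.op e)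
    (Submodule.sum_mem _ fun e he => hafter e (mem_filter.1 he).2.1 (mem_filter.1 he).2.2)
  -- The part of the detector between the two rounds, with all initialisations and readouts.
  set D' := D.filter fun e => P.isCheck e → a < P.time e ∧ P.time e < b with hD'
  have hpull : ∀ t, P.pullback (_root_.symmDiff D' (_root_.symmDiff A C)) 0 t =
      if a < t ∧ t ≤ b then P.pullback D 0 t else 0 := by
    intro t
    rw [pullback_symmDiff_zero, pullback_symmDiff_zero, hA', hC']
    have h0 := hD.2
    simp only [pullback, zero_add, hD', filter_filter, sum_filter] at h0 ⊢
    by_cases hta : t ≤ a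
    · rw [if_pos hta, if_pos (by omega), if_neg (by omega), ← sum_add_distrib,
        ← sum_add_distrib]
      refine Eq.trans ?_ h0
      refine sum_congr rfl fun e _ => ?_
      have := hchange e
      by_cases hc : P.isCheck e <;>
        simp only [hc, not_true_eq_false, not_false_eq_true, true_and, false_and, forall_const,
          false_implies, if_false] at this ⊢ <;>
        split_ifs <;> first | omega | simp
    · rw [if_neg hta, zero_add]
      by_cases htb : t ≤ b
      · rw [if_pos htb, if_pos (by omega), ← sum_add_distrib]
        refine sum_congr rfl fun e _ => ?_
        by_cases hc : P.isCheck e <;>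
          simp only [hc, true_and, false_and, forall_const, false_implies, if_false] <;>
          split_ifs <;> first | omega | simp
      · rw [if_neg htb, if_neg (by omega), add_zero]
        refine sum_eq_zero fun e _ => ?_
        have := hchange e
        by_cases hc : P.isCheck e <;>
          simp only [hc, not_true_eq_false, not_false_eq_true, forall_const,
            false_implies] at this ⊢ <;>
          split_ifs <;> first | omega | rfl
  have hdet : P.IsDetector (_root_.symmDiff D' (_root_.symmDiff A C)) := by
    refine ⟨⟨fun e => ?_, fun t ht q hq => ?_⟩, by simp [hpull]⟩
    · rw [hpull]
      split_ifs
      exacts [hD.1.1 e, symp_zero_left _]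
    · rw [hpull]
      split_ifs
      exacts [hD.1.2 t ht q hq, rfl]
  rw [← hu _ hdet, inversion, inversion, sum_symmDiff, sum_symmDiff, hA F ha', hC F hb', add_zero,
    add_zero]
  congr 1
  · simp [Procedure.window, hD', sum_filter]
  · refine sum_congr rfl fun t ht => ?_
    rw [hpull]
    simp only [Procedure.window]
    split_ifs <;> simp

section Weight

variable [Fintype E]

theorem weight_window_le (P : Procedure Ω E) (F : Fault Ω E) (a b : ℕ) :
    P.weight (P.window F a b) ≤ P.weight F := by
  classical
  refine add_le_add (sum_le_sum fun t _ => ?_) ?_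
  · simp only [window]
    split_ifs
    exacts [le_rfl, by simp]
  · refine card_le_card fun e => ?_
    simp only [window, mem_filter, mem_univ, true_and]
    intro h h0
    simp [h0] at h

/-- Pigeonhole principle: fewer wrong signs than rounds leave a round without any. -/
theorem exists_perfectRound {F : Fault Ω E} {S : Finset ℕ} (h : P.weight F < S.card) :
    ∃ k ∈ S, P.PerfectRound F k := by
  classical
  by_contra! hne
  have : S ⊆ (univ.filter fun e => F.flip e ≠ 0).image P.time := by
    intro k hk
    have := hne k hk
    simp only [PerfectRound, not_forall] at this
    obtain ⟨e, _, he, he'⟩ := this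
    exact mem_image.2 ⟨e, by simpa using he', he⟩
  have h1 := (card_le_card this).trans card_image_le
  have h2 : hammingNorm F.flip ≤ P.weight F := Nat.le_add_left _ _
  have h3 : hammingNorm F.flip = (univ.filter fun e => F.flip e ≠ 0).card := rfl
  omega

end Weight

end Procedure

/-! ### Addresses in the tree -/

namespace SplitTree

variable {ι : Type*}

theorem labels_nil (t : SplitTree ι) : t.labels [] = t.leaves := by cases t <;> rfl

theorem labels_concat_subset (t : SplitTree ι) (a : List Bool) (x : Bool) :
    t.labels (a ++ [x]) ⊆ t.labels a := by
  induction t generalizing a with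
  | leaf i => cases a <;> simp [labels]
  | node l r hl hr =>
    rcases a with _ | ⟨y, a⟩
    · cases x <;> simp [labels, leaves, labels_nil]
    · cases y
      exacts [hl a, hr a]

/-- The parent of a vertex is a vertex. -/
theorem mem_nodes_of_concat_mem {t : SplitTree ι} {a : List Bool} {x : Bool}
    (h : a ++ [x] ∈ t.nodes) : a ∈ t.nodes := by
  induction t generalizing a with
  | leaf i => simp [nodes] at h
  | node l r hl hr =>
    rcases a with _ | ⟨y, a⟩
    · simp [nodes]
    · cases y <;> simp only [nodes, List.cons_append, mem_insert, reduceCtorEq, mem_union,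
        mem_image, List.cons.injEq, true_and, false_and, and_false, exists_false, or_false,
        false_or, exists_eq_right] at h ⊢
      exacts [hl h, hr h]

end SplitTree

namespace Branching

variable {n J ι : Type*} [Fintype n] [Fintype J] [DecidableEq n] [DecidableEq J]
variable {B : Branching n J ι}

theorem Branch.ne_nil (a : B.Branch) : a.1 ≠ [] := (mem_erase.1 a.2).1

theorem Branch.ne_dropLast (a : B.Branch) : a.1 ≠ a.1.dropLast := by
  intro h
  have h' := congrArg List.length h
  have := List.length_pos_iff.2 (Branch.ne_nil a)
  rw [List.length_dropLast] at h'
  omega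

theorem Branch.parent_mem (a : B.Branch) (h : a.1.dropLast ≠ []) :
    a.1.dropLast ∈ B.tree.nodes.erase [] := by
  refine mem_erase.2 ⟨h, SplitTree.mem_nodes_of_concat_mem (x := a.1.getLast a.ne_nil) ?_⟩
  rw [List.dropLast_append_getLast]
  exact (mem_erase.1 a.2).2

variable (B)

theorem bits_subset_parent (a : B.Branch) : B.bits a.1 ⊆ B.bits a.1.dropLast := by
  intro q hq
  obtain ⟨i, hi, hiq⟩ := (mem_filter.1 hq).2
  refine mem_filter.2 ⟨mem_univ _, i, ?_, hiq⟩
  refine B.tree.labels_concat_subset _ (a.1.getLast a.ne_nil) ?_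
  rwa [List.dropLast_append_getLast]

theorem incidentChecks_subset_parent (a : B.Branch) :
    B.incidentChecks a.1 ⊆ B.incidentChecks a.1.dropLast := by
  intro j hj
  obtain ⟨q, hq, hjq⟩ := (mem_filter.1 hj).2
  exact mem_filter.2 ⟨mem_univ _, q, B.bits_subset_parent a hq, hjq⟩

variable {B}

theorem BitSite.exists_parent (v : B.BitSite) (h : v.1.1.1.dropLast ≠ []) :
    ∃ w : B.BitSite, w.1.1.1 = v.1.1.1.dropLast ∧ w.1.2 = v.1.2 :=
  ⟨⟨(⟨_, Branch.parent_mem v.1.1 h⟩, v.1.2), B.bits_subset_parent _ v.2⟩, rfl, rfl⟩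

theorem CheckSite.exists_parent (p : B.CheckSite) (h : p.1.1.1.dropLast ≠ []) :
    ∃ r : B.CheckSite, r.1.1.1 = p.1.1.1.dropLast ∧ r.1.2 = p.1.2 :=
  ⟨⟨(⟨_, Branch.parent_mem p.1.1 h⟩, p.1.2), B.incidentChecks_subset_parent _ p.2⟩, rfl, rfl⟩

theorem exists_checkSite (v : B.BitSite) {j : J} (h : B.Incident j v.1.2) :
    ∃ p : B.CheckSite, p.1.1.1 = v.1.1.1 ∧ p.1.2 = j :=
  ⟨⟨(v.1.1, j), mem_filter.2 ⟨mem_univ _, v.1.2, v.2, h⟩⟩, rfl, rfl⟩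

theorem BitSite.ext {v w : B.BitSite} (h : v.1.1.1 = w.1.1.1) (h' : v.1.2 = w.1.2) : v = w :=
  Subtype.ext (Prod.ext (Subtype.ext h) h')

theorem CheckSite.ext {v w : B.CheckSite} (h : v.1.1.1 = w.1.1.1) (h' : v.1.2 = w.1.2) : v = w :=
  Subtype.ext (Prod.ext (Subtype.ext h) h')

theorem sum_bitSite_eq {M : Type*} [AddCommMonoid M] (w : B.BitSite) (f : B.BitSite → M)
    {a : List Bool} {q : n} (ha : w.1.1.1 = a) (hq : w.1.2 = q) :
    (∑ b : B.BitSite, if b.1.1.1 = a ∧ b.1.2 = q then f b else 0) = f w := by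
  rw [sum_eq_single w, if_pos ⟨ha, hq⟩]
  · intro b _ hb
    exact if_neg fun h => hb (BitSite.ext (h.1.trans ha.symm) (h.2.trans hq.symm))
  · simp

theorem sum_checkSite_eq {M : Type*} [AddCommMonoid M] (w : B.CheckSite) (f : B.CheckSite → M)
    {a : List Bool} {j : J} (ha : w.1.1.1 = a) (hj : w.1.2 = j) :
    (∑ b : B.CheckSite, if b.1.1.1 = a ∧ b.1.2 = j then f b else 0) = f w := by
  rw [sum_eq_single w, if_pos ⟨ha, hj⟩]
  · intro b _ hb
    exact if_neg fun h => hb (CheckSite.ext (h.1.trans ha.symm) (h.2.trans hj.symm))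
  · simp

/-! ### Operators that use only the letter `transL` on the new qubits -/

variable (B)

/-- The operator acts on each new qubit by `transL` or trivially. -/
def IsTrans (O : Pauli B.Qubit) : Prop := ∀ e : B.Anc, ∃ c : ZMod 2, O (.inr e) = c • B.transL

/-- The operator that `O` induces on the original qubits. -/
def restrict (O : Pauli B.Qubit) : Pauli n := fun q => O (.inl q)

variable {B}

theorem trans_copy : Letter.symp B.transL B.copyL = 1 := by
  rw [Letter.symp_comm, B.letters_anticomm]

theorem isTrans_ite {p : B.Anc → Prop} [DecidablePred p] {O : Pauli B.Qubit}
    (h : ∀ e, O (.inr e) = if p e then B.transL else 0) : B.IsTrans O := fun e =>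
  ⟨if p e then 1 else 0, by rw [h]; split_ifs <;> simp⟩

theorem isTrans_oldOp (j : J) : B.IsTrans (B.oldOp j) := fun _ => ⟨0, by simp [oldOp]⟩

theorem isTrans_ancOp (e : B.Anc) : B.IsTrans (B.ancOp e) :=
  isTrans_ite (p := fun e' => e' = e) fun _ => rfl

theorem isTrans_deformedOp (j : J) : B.IsTrans (B.deformedOp j) := by
  rintro (b | c)
  · exact ⟨0, by simp [deformedOp]⟩
  · exact ⟨if c.1.2 = j ∧ c.1.1.1.dropLast = [] then 1 else 0, by
      simp only [deformedOp]; split_ifs <;> simp⟩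

theorem isTrans_faceOp (p : B.CheckSite) : B.IsTrans (B.faceOp p) := by
  rintro (b | c) <;> simp only [faceOp] <;> split_ifs
  exacts [⟨1, by simp⟩, ⟨0, by simp⟩, ⟨1, by simp⟩, ⟨0, by simp⟩]

theorem IsTrans.add {O O' : Pauli B.Qubit} (h : B.IsTrans O) (h' : B.IsTrans O') :
    B.IsTrans (O + O') := fun e => by
  obtain ⟨c, hc⟩ := h e
  obtain ⟨c', hc'⟩ := h' e
  exact ⟨c + c', by rw [Pi.add_apply, hc, hc', add_smul]⟩

theorem IsTrans.sum {K : Type*} {s : Finset K} {O : K → Pauli B.Qubit}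
    (h : ∀ k ∈ s, B.IsTrans (O k)) : B.IsTrans (∑ k ∈ s, O k) := by
  classical
  induction s using Finset.induction_on with
  | empty => exact fun e => ⟨0, by simp⟩
  | insert k s hk ih =>
    rw [sum_insert hk]
    exact (h k (mem_insert_self _ _)).add (ih fun k' hk' => h k' (mem_insert_of_mem hk'))

theorem IsTrans.smul {O : Pauli B.Qubit} (h : B.IsTrans O) (r : ZMod 2) : B.IsTrans (r • O) :=
  fun e => by
    obtain ⟨c, hc⟩ := h e
    exact ⟨r * c, by rw [Pi.smul_apply, hc, mul_smul]⟩

theorem symp_of_isTrans {O O' : Pauli B.Qubit} (h : B.IsTrans O) (h' : B.IsTrans O') :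
    symp O O' = symp (B.restrict O) (B.restrict O') := by
  rw [symp, Fintype.sum_sum_type]
  refine (add_eq_left).2 (sum_eq_zero fun e _ => ?_)
  obtain ⟨c, hc⟩ := h e
  obtain ⟨c', hc'⟩ := h' e
  rw [hc, hc', Letter.symp_smul, Letter.symp_comm, Letter.symp_smul, Letter.symp_self, mul_zero,
    mul_zero]

theorem IsTrans.eq_zero {O : Pauli B.Qubit} (h : B.IsTrans O) {e : B.Anc}
    (he : Letter.symp (O (.inr e)) B.copyL = 0) : O (.inr e) = 0 := by
  obtain ⟨c, hc⟩ := h e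
  rw [hc, Letter.symp_smul, trans_copy, mul_one] at he
  rw [hc, he, zero_smul]

/-! ### Commutation with the vertex checks -/

variable (B)

/-- Whether (`1`) or not (`0`) an operator anticommutes on the bit `q` of the tree vertex `a` with
the vertex checks there. The bits of the root are the original qubits. -/
def bitAt (O : Pauli B.Qubit) (a : List Bool) (q : n) : ZMod 2 :=
  if a = [] then Letter.symp (O (.inl q)) (B.letter q)
  else ∑ b : B.BitSite,
    if b.1.1.1 = a ∧ b.1.2 = q then Letter.symp (O (.inr (.inl b))) B.copyL else 0

variable {B}

theorem bitAt_nil (O : Pauli B.Qubit) (q : n) :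
    B.bitAt O [] q = Letter.symp (O (.inl q)) (B.letter q) := if_pos rfl

theorem bitAt_site (O : Pauli B.Qubit) (b : B.BitSite) {a : List Bool} {q : n}
    (ha : b.1.1.1 = a) (hq : b.1.2 = q) :
    B.bitAt O a q = Letter.symp (O (.inr (.inl b))) B.copyL := by
  rw [bitAt, if_neg (ha ▸ b.1.1.ne_nil), sum_bitSite_eq b _ ha hq]

/-- A vertex check compares a bit of a branch to the same bit of its parent. -/
theorem symp_vertexOp (O : Pauli B.Qubit) (v : B.BitSite) :
    symp O (B.vertexOp v) = B.bitAt O v.1.1.1 v.1.2 + B.bitAt O v.1.1.1.dropLast v.1.2 +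
      ∑ c : B.CheckSite, if c.1.1.1 = v.1.1.1 ∧ B.Incident c.1.2 v.1.2 then
        Letter.symp (O (.inr (.inr c))) B.copyL else 0 := by
  have hL : ∀ (p : Prop) [Decidable p] (x y : Letter),
      Letter.symp x (if p then y else 0) = if p then Letter.symp x y else 0 := by
    intro p _ x y
    split_ifs <;> simp
  rw [symp, Fintype.sum_sum_type, Fintype.sum_sum_type, ← add_assoc]
  simp only [vertexOp, hL]
  congr 1
  have hne := Branch.ne_dropLast v.1.1
  have hb : (∑ b : B.BitSite, if b.1.2 = v.1.2 ∧ (b.1.1.1 = v.1.1.1 ∨ b.1.1.1 = v.1.1.1.dropLast)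
      then Letter.symp (O (.inr (.inl b))) B.copyL else 0) =
      B.bitAt O v.1.1.1 v.1.2 + ∑ b : B.BitSite, if b.1.1.1 = v.1.1.1.dropLast ∧ b.1.2 = v.1.2
      then Letter.symp (O (.inr (.inl b))) B.copyL else 0 := by
    rw [bitAt, if_neg v.1.1.ne_nil, ← sum_add_distrib]
    refine sum_congr rfl fun b _ => ?_
    by_cases h1 : b.1.2 = v.1.2
    · by_cases h2 : b.1.1.1 = v.1.1.1
      · simp [h1, h2, hne]
      · simp [h1, h2]
    · simp [h1]
  rw [hb]
  by_cases h : v.1.1.1.dropLast = []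
  · rw [h, bitAt_nil]
    have h0 : (∑ b : B.BitSite, if b.1.1.1 = [] ∧ b.1.2 = v.1.2
        then Letter.symp (O (.inr (.inl b))) B.copyL else 0) = 0 :=
      sum_eq_zero fun b _ => if_neg fun h => b.1.1.ne_nil h.1
    rw [h0, add_zero, add_comm]
    simp
  · simp only [h, false_and, if_false, sum_const_zero, zero_add]
    congr 1
    rw [bitAt, if_neg h]

theorem symp_vertexOp_vertexOp (v w : B.BitSite) : symp (B.vertexOp w) (B.vertexOp v) = 0 := by
  refine sum_eq_zero fun x _ => ?_
  rcases x with q | b | c <;> simp only [vertexOp] <;> split_ifs <;> simp [Letter.symp_self]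

/-- If the branch of `v` is attached to the root and `j` is incident to its bit, the two checks overlap
in two anticommuting letters: on the bit itself and on the first-layer qubit `j` of the branch. -/
theorem symp_deformedOp_vertexOp (j : J) (v : B.BitSite) :
    symp (B.deformedOp j) (B.vertexOp v) = 0 := by
  rw [symp_vertexOp, bitAt_site _ v rfl rfl]
  by_cases h : v.1.1.1.dropLast = []
  · rw [h, bitAt_nil]
    simp only [deformedOp, Letter.zero_symp, zero_add]
    by_cases hj : B.Incident j v.1.2
    · obtain ⟨p, hp, hpj⟩ := exists_checkSite v hj
      rw [sum_eq_single p]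
      · have hj' : Letter.symp (B.check j v.1.2) (B.letter v.1.2) = 1 := hj
        rw [if_pos ⟨hp, hpj ▸ hj⟩, if_pos ⟨hpj, hp ▸ h⟩, trans_copy, hj']
        rfl
      · intro c _ hc
        split_ifs with h1 h2
        · exact absurd (CheckSite.ext (h1.1.trans hp.symm) (h2.1.trans hpj.symm)) hc
        · simp
        · rfl
      · simp
    · have hj' : Letter.symp (B.check j v.1.2) (B.letter v.1.2) = 0 := by
        have : ∀ x : ZMod 2, x ≠ 1 → x = 0 := by decide
        exact this _ hj
      rw [hj', zero_add]
      refine sum_eq_zero fun c _ => ?_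
      split_ifs with h1 h2
      · exact absurd (h2.1 ▸ h1.2) hj
      · simp
      · rfl
  · obtain ⟨w, hw, hwq⟩ := BitSite.exists_parent v h
    rw [bitAt_site _ w hw hwq]
    simp only [deformedOp, Letter.zero_symp, zero_add]
    refine sum_eq_zero fun c _ => ?_
    split_ifs with h1 h2
    · exact absurd (h1.1 ▸ h2.2) h
    · simp
    · rfl

/-- If `p` copies the check `j` in the branch `a` and `v` is the bit `q` of a branch `c`, the checks
overlap only if `j` is incident to `q` and `a` is `c` or its parent. Then they overlap in two
qubits: the bit `q` of `a` and the first-layer qubit `j` of `c`. -/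
theorem symp_faceOp_vertexOp (p : B.CheckSite) (v : B.BitSite) :
    symp (B.faceOp p) (B.vertexOp v) = 0 := by
  have hne := Branch.ne_dropLast v.1.1
  have hpar : B.bitAt (B.faceOp p) v.1.1.1.dropLast v.1.2 =
      if v.1.1.1.dropLast = p.1.1.1 ∧ B.Incident p.1.2 v.1.2 then 1 else 0 := by
    by_cases h : v.1.1.1.dropLast = []
    · rw [h, bitAt_nil, if_neg fun h' => p.1.1.ne_nil h'.1.symm]
      simp [faceOp]
    · obtain ⟨w, hw, hwq⟩ := BitSite.exists_parent v h
      rw [bitAt_site _ w hw hwq]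
      simp only [faceOp, hw, hwq]
      split_ifs
      exacts [trans_copy, Letter.zero_symp _]
  rw [symp_vertexOp, bitAt_site _ v rfl rfl, hpar]
  simp only [faceOp]
  by_cases hj : B.Incident p.1.2 v.1.2
  · obtain ⟨r, hr, hrj⟩ := exists_checkSite v hj
    rw [sum_eq_single r]
    · by_cases h1 : v.1.1.1 = p.1.1.1
      · have h2 : ¬ v.1.1.1.dropLast = p.1.1.1 := fun h2 => hne (h1.trans h2.symm)
        simp [hr, hrj, hj, ← h1, hne.symm, trans_copy]
        rfl
      · by_cases h2 : v.1.1.1.dropLast = p.1.1.1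
        · simp [hr, hrj, hj, h1, h2, trans_copy]
          rfl
        · simp [hr, hrj, hj, h1, h2]
    · intro c _ hc
      split_ifs with h1 h2
      · exact absurd (CheckSite.ext (h1.1.trans hr.symm) (h2.1.trans hrj.symm)) hc
      · simp
      · rfl
    · simp
  · have : ∀ c : B.CheckSite, ¬ (B.Incident c.1.2 v.1.2 ∧ c.1.2 = p.1.2) := fun c h =>
      hj (h.2 ▸ h.1)
    simp only [hj, and_false, if_false, Letter.zero_symp, zero_add]
    refine sum_eq_zero fun c _ => ?_
    split_ifs with h1 h2
    · exact absurd ⟨h1.2, h2.1⟩ (this c)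
    · simp
    · rfl

theorem symp_newOp_vertexOp (k : B.NewCheck) (v : B.BitSite) :
    symp (B.newOp k) (B.vertexOp v) = 0 := by
  rcases k with j | w | p
  exacts [symp_deformedOp_vertexOp j v, symp_vertexOp_vertexOp v w, symp_faceOp_vertexOp p v]

/-- An operator made of letters `transL` on new qubits that commutes with the vertex checks is a
product of face checks. Going down the tree, each face check removes the letter on its own
first-layer qubit, and then the vertex checks force the letters on the second layers to vanish. -/
theorem mem_span_faceOp {O : Pauli B.Qubit} (hO : B.IsTrans O) (hr : B.restrict O = 0)
    (hv : ∀ v, symp O (B.vertexOp v) = 0) :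
    O ∈ Submodule.span (ZMod 2) (Set.range B.faceOp) := by
  classical
  set x : B.CheckSite → ZMod 2 := fun c => Letter.symp (O (.inr (.inr c))) B.copyL with hx
  -- The exponent of a face check is the sum of the exponents of `O` on the path to the root.
  set y : List Bool → J → ZMod 2 := fun a j =>
    ∑ c : B.CheckSite, if c.1.2 = j ∧ c.1.1.1 <+: a then x c else 0 with hy
  have hy_nil : ∀ j, y [] j = 0 := fun j => sum_eq_zero fun c _ =>
    if_neg fun h => c.1.1.ne_nil (List.prefix_nil.1 h.2)
  have hy_step : ∀ c : B.CheckSite, y c.1.1.1 c.1.2 = x c + y c.1.1.1.dropLast c.1.2 := by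
    intro c
    rw [← sum_checkSite_eq c x rfl rfl, hy]
    dsimp only
    rw [← sum_add_distrib]
    refine sum_congr rfl fun b _ => ?_
    have hpre : b.1.1.1 <+: c.1.1.1 ↔ b.1.1.1 = c.1.1.1 ∨ b.1.1.1 <+: c.1.1.1.dropLast := by
      conv_lhs => rw [← List.dropLast_append_getLast c.1.1.ne_nil]
      rw [List.prefix_concat_iff, List.dropLast_append_getLast]
    have hnot : b.1.1.1 = c.1.1.1 → ¬ b.1.1.1 <+: c.1.1.1.dropLast := by
      intro h h'
      have := h'.length_le
      have := List.length_pos_iff.2 (Branch.ne_nil c.1.1)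
      rw [h, List.length_dropLast] at *
      omega
    by_cases h1 : b.1.2 = c.1.2
    · by_cases h2 : b.1.1.1 = c.1.1.1
      · have := hnot h2
        rw [if_pos ⟨h1, hpre.2 (Or.inl h2)⟩, if_pos ⟨h2, h1⟩, if_neg fun h => this h.2, add_zero]
      · simp [h1, hpre, h2]
    · simp [h1]
  set Z : Pauli B.Qubit := O + ∑ p : B.CheckSite, y p.1.1.1 p.1.2 • B.faceOp p with hZ
  have hZt : B.IsTrans Z := hO.add (IsTrans.sum fun p _ => (isTrans_faceOp p).smul _)
  have hZl : ∀ q, Z (.inl q) = 0 := by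
    intro q
    have : O (.inl q) = 0 := congrFun hr q
    simp [hZ, this, faceOp]
  have hZc : ∀ c : B.CheckSite, Letter.symp (Z (.inr (.inr c))) B.copyL = 0 := by
    intro c
    have hsum : ∀ (s : Finset B.CheckSite) (f : B.CheckSite → Letter),
        Letter.symp (∑ p ∈ s, f p) B.copyL = ∑ p ∈ s, Letter.symp (f p) B.copyL := by
      intro s f
      induction s using Finset.induction_on with
      | empty => simp
      | insert k s hk ih => rw [sum_insert hk, sum_insert hk, Letter.symp_add, ih]
    have hterm : ∀ p : B.CheckSite,
        Letter.symp (y p.1.1.1 p.1.2 • B.faceOp p (.inr (.inr c))) B.copyL =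
        (if p.1.1.1 = c.1.1.1 ∧ p.1.2 = c.1.2 then y p.1.1.1 p.1.2 else 0) +
        (if p.1.1.1 = c.1.1.1.dropLast ∧ p.1.2 = c.1.2 then y p.1.1.1 p.1.2 else 0) := by
      intro p
      have hne := Branch.ne_dropLast c.1.1
      rw [Letter.symp_smul]
      simp only [faceOp, @eq_comm _ p.1.1.1, @eq_comm _ p.1.2]
      by_cases h1 : c.1.2 = p.1.2
      · by_cases h2 : c.1.1.1 = p.1.1.1
        · have h3 : ¬ c.1.1.1.dropLast = p.1.1.1 := fun h3 => hne (h2.trans h3.symm)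
          simp [h1, ← h2, hne.symm, trans_copy]
        · by_cases h3 : c.1.1.1.dropLast = p.1.1.1
          · simp [h1, h2, h3, trans_copy]
          · simp [h1, h2, h3]
      · simp [h1]
    simp only [hZ, Pi.add_apply, Finset.sum_apply, Pi.smul_apply]
    rw [Letter.symp_add, hsum]
    simp only [hterm]
    rw [sum_add_distrib, sum_checkSite_eq c (fun p => y p.1.1.1 p.1.2) rfl rfl, hy_step]
    have hpar : (∑ p : B.CheckSite, if p.1.1.1 = c.1.1.1.dropLast ∧ p.1.2 = c.1.2
        then y p.1.1.1 p.1.2 else 0) = y c.1.1.1.dropLast c.1.2 := by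
      by_cases h : c.1.1.1.dropLast = []
      · rw [h, hy_nil]
        exact sum_eq_zero fun p _ => if_neg fun h' => p.1.1.ne_nil h'.1
      · obtain ⟨w, hw, hwj⟩ := CheckSite.exists_parent c h
        rw [sum_checkSite_eq w (fun p => y p.1.1.1 p.1.2) hw hwj, hw, hwj]
    rw [hpar]
    change x c + (x c + _ + _) = 0
    rw [add_assoc, CharTwo.add_self_eq_zero, add_zero, CharTwo.add_self_eq_zero]
  have hZv : ∀ v, symp Z (B.vertexOp v) = 0 := by
    intro v
    rw [hZ, symp_add_left, hv, symp_sum_left, zero_add]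
    refine sum_eq_zero fun p _ => ?_
    rw [← sympForm_apply, map_smul, LinearMap.smul_apply, sympForm_apply, symp_faceOp_vertexOp,
      smul_zero]
  have hZb : ∀ (k : ℕ) (v : B.BitSite), v.1.1.1.length ≤ k →
      Letter.symp (Z (.inr (.inl v))) B.copyL = 0 := by
    intro k
    induction k with
    | zero =>
      intro v hk
      exact absurd (List.length_eq_zero_iff.1 (Nat.le_zero.1 hk)) v.1.1.ne_nil
    | succ k ih =>
      intro v hk
      have h0 := hZv v
      rw [symp_vertexOp, bitAt_site _ v rfl rfl, sum_eq_zero (s := univ) fun c _ => ?_] at h0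
      · have hpar : B.bitAt Z v.1.1.1.dropLast v.1.2 = 0 := by
          by_cases h : v.1.1.1.dropLast = []
          · rw [h, bitAt_nil, hZl, Letter.zero_symp]
          · obtain ⟨w, hw, hwq⟩ := BitSite.exists_parent v h
            rw [bitAt_site _ w hw hwq]
            refine ih w ?_
            rw [hw, List.length_dropLast]
            omega
        rwa [hpar, add_zero, add_zero] at h0
      · rw [hZc, ite_self]
  have hZ0 : Z = 0 := by
    funext e
    rcases e with q | b | c
    · exact hZl q
    · exact hZt.eq_zero (hZb _ b le_rfl)
    · exact hZt.eq_zero (hZc c)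
  have hOsum : O = ∑ p : B.CheckSite, y p.1.1.1 p.1.2 • B.faceOp p := by
    rw [← add_zero O, ← ZModModule.add_self (∑ p : B.CheckSite, y p.1.1.1 p.1.2 • B.faceOp p),
      ← add_assoc]
    change Z + _ = _
    rw [hZ0, zero_add]
  rw [hOsum]
  exact Submodule.sum_mem _ fun p _ => Submodule.smul_mem _ _ (Submodule.subset_span ⟨p, rfl⟩)

/-! ### Extending logical operators to the branched code -/

/-- Extension of operators of the original code to the branched code: the letter `transL` is added
on the copies of those qubits where the operator anticommutes with the logical operators that
are branched. This makes it commute with the vertex checks. -/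
def extend (B : Branching n J ι) : Pauli n →ₗ[ZMod 2] Pauli B.Qubit where
  toFun M
    | .inl q => M q
    | .inr (.inl b) => Letter.symp (M b.1.2) (B.letter b.1.2) • B.transL
    | .inr (.inr _) => 0
  map_add' M N := by
    funext x
    rcases x with q | b | c <;> simp [Letter.symp_add, add_smul]
  map_smul' r M := by
    funext x
    rcases x with q | b | c <;> simp [Letter.symp_smul, mul_smul]

/-- The operators of the original code, acting trivially on the new qubits. -/
def inclusion (B : Branching n J ι) (M : Pauli n) : Pauli B.Qubit := Sum.elim M 0

/-- The adjoint of `extend` for the commutation form: a letter on a copy of the qubit `q` that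
anticommutes with `transL` becomes the letter of the branched logical operators on `q`, and the
other new qubits are ignored. -/
def collapse (B : Branching n J ι) (Z : Pauli B.Qubit) : Pauli n := fun q =>
  Z (.inl q) + (∑ b : B.BitSite,
    if b.1.2 = q then Letter.symp (Z (.inr (.inl b))) B.transL else 0) • B.letter q

theorem isTrans_extend (M : Pauli n) : B.IsTrans (B.extend M) := by
  rintro (b | c)
  exacts [⟨_, rfl⟩, ⟨0, by simp [extend]⟩]

theorem isTrans_inclusion (M : Pauli n) : B.IsTrans (B.inclusion M) :=
  fun _ => ⟨0, by simp [inclusion]⟩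

theorem restrict_extend (M : Pauli n) : B.restrict (B.extend M) = M := rfl

theorem restrict_inclusion (M : Pauli n) : B.restrict (B.inclusion M) = M := rfl

theorem restrict_oldOp (j : J) : B.restrict (B.oldOp j) = B.check j := rfl

theorem restrict_deformedOp (j : J) : B.restrict (B.deformedOp j) = B.check j := rfl

theorem restrict_ancOp (e : B.Anc) : B.restrict (B.ancOp e) = 0 := rfl

theorem restrict_add (O O' : Pauli B.Qubit) :
    B.restrict (O + O') = B.restrict O + B.restrict O' := rfl

theorem restrict_sum {K : Type*} (s : Finset K) (O : K → Pauli B.Qubit) :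
    B.restrict (∑ k ∈ s, O k) = ∑ k ∈ s, B.restrict (O k) := by
  funext q
  simp [restrict]

theorem symp_extend_vertexOp (M : Pauli n) (v : B.BitSite) :
    symp (B.extend M) (B.vertexOp v) = 0 := by
  have hval : ∀ b : B.BitSite, Letter.symp (B.extend M (.inr (.inl b))) B.copyL =
      Letter.symp (M b.1.2) (B.letter b.1.2) := fun b => by
    change Letter.symp (Letter.symp (M b.1.2) (B.letter b.1.2) • B.transL) B.copyL = _
    rw [Letter.symp_smul, trans_copy, mul_one]
  have hpar : B.bitAt (B.extend M) v.1.1.1.dropLast v.1.2 =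
      Letter.symp (M v.1.2) (B.letter v.1.2) := by
    by_cases h : v.1.1.1.dropLast = []
    · rw [h, bitAt_nil]
      rfl
    · obtain ⟨w, hw, hwq⟩ := BitSite.exists_parent v h
      rw [bitAt_site _ w hw hwq, hval, hwq]
  rw [symp_vertexOp, bitAt_site _ v rfl rfl, hpar, hval, CharTwo.add_self_eq_zero, zero_add]
  refine sum_eq_zero fun c _ => ?_
  change (if _ then Letter.symp 0 B.copyL else 0) = 0
  simp

theorem symp_extend_newOp {M : Pauli n} (hM : ∀ j, symp M (B.check j) = 0) (k : B.NewCheck) :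
    symp (B.extend M) (B.newOp k) = 0 := by
  rcases k with j | v | p
  · exact (symp_of_isTrans (isTrans_extend M) (isTrans_deformedOp j)).trans (hM j)
  · exact symp_extend_vertexOp M v
  · exact (symp_of_isTrans (isTrans_extend M) (isTrans_faceOp p)).trans (symp_zero_right _)

theorem symp_isTrans_ancOp {O : Pauli B.Qubit} (hO : B.IsTrans O) (e : B.Anc) :
    symp O (B.ancOp e) = 0 :=
  (symp_of_isTrans hO (isTrans_ancOp e)).trans (symp_zero_right _)

theorem span_faceOp_le : Submodule.span (ZMod 2) (Set.range B.faceOp) ≤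
    Submodule.span (ZMod 2) (Set.range B.newOp) :=
  Submodule.span_mono (Set.range_subset_iff.2 fun p => ⟨.inr (.inr p), rfl⟩)

theorem extend_check_mem_span (j : J) :
    B.extend (B.check j) ∈ Submodule.span (ZMod 2) (Set.range B.newOp) := by
  have h : B.extend (B.check j) + B.deformedOp j ∈
      Submodule.span (ZMod 2) (Set.range B.faceOp) := by
    refine mem_span_faceOp ((isTrans_extend _).add (isTrans_deformedOp j)) ?_ fun v => ?_
    · rw [restrict_add, restrict_extend, restrict_deformedOp, ZModModule.add_self]
    · rw [symp_add_left, symp_extend_vertexOp, symp_deformedOp_vertexOp, add_zero]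
  have h' := Submodule.add_mem _
    (span_faceOp_le h)
    (Submodule.subset_span (R := ZMod 2) (s := Set.range B.newOp) ⟨.inl j, rfl⟩)
  rwa [newOp, add_assoc, ZModModule.add_self, add_zero] at h'

/-- A product of original checks and letters `transL` on new qubits which commutes with the vertex
checks is a product of checks of the branched code. -/
theorem mem_span_newOp {O : Pauli B.Qubit} (hO : B.IsTrans O)
    (hr : B.restrict O ∈ Submodule.span (ZMod 2) (Set.range B.check))
    (hv : ∀ v, symp O (B.vertexOp v) = 0) :
    O ∈ Submodule.span (ZMod 2) (Set.range B.newOp) := by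
  have hext : B.extend (B.restrict O) ∈ Submodule.span (ZMod 2) (Set.range B.newOp) := by
    have hle : Submodule.span (ZMod 2) (Set.range B.check) ≤
        (Submodule.span (ZMod 2) (Set.range B.newOp)).comap B.extend :=
      Submodule.span_le.2 (Set.range_subset_iff.2 extend_check_mem_span)
    exact hle hr
  have h : O + B.extend (B.restrict O) ∈ Submodule.span (ZMod 2) (Set.range B.faceOp) := by
    refine mem_span_faceOp (hO.add (isTrans_extend _)) ?_ fun v => ?_
    · rw [restrict_add, restrict_extend, ZModModule.add_self]
    · rw [symp_add_left, symp_extend_vertexOp, hv, add_zero]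
  have h' := Submodule.add_mem _
    (span_faceOp_le h) hext
  rwa [add_assoc, ZModModule.add_self, add_zero] at h'

theorem symp_collapse (Z : Pauli B.Qubit) (M : Pauli n) :
    symp (B.collapse Z) M = symp Z (B.extend M) := by
  have h1 : ∀ q, Letter.symp (B.collapse Z q) (M q) = Letter.symp (Z (.inl q)) (M q) +
      ∑ b : B.BitSite, if q = b.1.2 then
        Letter.symp (Z (.inr (.inl b))) B.transL * Letter.symp (B.letter q) (M q) else 0 := by
    intro q
    rw [collapse, Letter.symp_add, Letter.symp_smul, sum_mul]
    congr 1
    refine sum_congr rfl fun b _ => ?_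
    simp only [@eq_comm _ q]
    split_ifs
    exacts [rfl, zero_mul _]
  rw [symp, symp, Fintype.sum_sum_type, Fintype.sum_sum_type, sum_congr rfl fun q _ => h1 q,
    sum_add_distrib, sum_comm]
  congr 1
  have h2 : ∀ c : B.CheckSite, Letter.symp (Z (.inr (.inr c))) (B.extend M (.inr (.inr c))) = 0 :=
    fun c => Letter.symp_zero _
  rw [sum_eq_zero (s := (univ : Finset B.CheckSite)) fun c _ => h2 c, add_zero]
  refine sum_congr rfl fun b _ => ?_
  rw [sum_ite_eq' univ b.1.2, if_pos (mem_univ _)]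
  change _ = Letter.symp _ (Letter.symp (M b.1.2) (B.letter b.1.2) • B.transL)
  rw [Letter.symp_comm _ (_ • _), Letter.symp_smul, Letter.symp_comm B.transL,
    Letter.symp_comm (B.letter _), mul_comm]

theorem hammingNorm_collapse_le (Z : Pauli B.Qubit) :
    hammingNorm (B.collapse Z) ≤ hammingNorm Z := by
  classical
  -- The original qubit to which `collapse` moves the letter of a qubit.
  let π : B.Qubit → Option n := Sum.elim some (Sum.elim (fun b => some b.1.2) fun _ => none)
  have hsub : (univ.filter fun q => B.collapse Z q ≠ 0).image some ⊆
      (univ.filter fun x => Z x ≠ 0).image π := by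
    intro o ho
    obtain ⟨q, hq, rfl⟩ := mem_image.1 ho
    by_contra hne
    refine (mem_filter.1 hq).2 ?_
    have hZ : ∀ x, π x = some q → Z x = 0 := by
      intro x hx
      by_contra hZx
      exact hne (mem_image.2 ⟨x, by simpa using hZx, hx⟩)
    rw [collapse, hZ (.inl q) rfl, zero_add, sum_eq_zero, zero_smul]
    intro b _
    split_ifs with hb
    · rw [hZ (.inr (.inl b)) (congrArg some hb), Letter.zero_symp]
    · rfl
  have h := (card_le_card hsub).trans card_image_le
  rwa [card_image_of_injective _ (Option.some_injective n)] at h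

/-- Errors of weight less than the distance of the original code cannot invert an extended logical
operator without inverting an extended check. -/
theorem symp_extend_eq_zero {d : ℕ} (hd : IsCodeDistance B.check d) {Z : Pauli B.Qubit}
    (hZ : hammingNorm Z < d) (hcheck : ∀ j, symp Z (B.extend (B.check j)) = 0) {M : Pauli n}
    (hM : ∀ j, symp M (B.check j) = 0) : symp Z (B.extend M) = 0 := by
  rw [← symp_collapse, symp_comm]
  refine symp_eq_zero_of_mem_span (S := Set.range B.check)
    (Set.forall_mem_range.2 hM) ?_
  by_contra hne
  have : d ≤ hammingNorm (B.collapse Z) :=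
    hd.2 ⟨B.collapse Z, ⟨fun j => by rw [symp_collapse, hcheck], hne⟩, rfl⟩
  have := hammingNorm_collapse_le Z
  omega

/-! ### Fault-distance of a change between the original and the branched code -/

/-- The events on new qubits, among those listed by `anc`, by which an operator `M` of the original
code differs from its extension to the branched code. -/
def ancEvents (B : Branching n J ι) {E : Type*} (anc : B.Anc ↪ E) (M : Pauli n) : Finset E :=
  (univ.filter fun e => B.extend M (.inr e) ≠ 0).map anc

/-- What is common to branching and un-branching: a procedure that changes at time `s` between the
original and the branched code. The events on single new qubits are listed by `anc`, and `out M`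
is the form, either `M` or its extension, that a logical operator `M` of the original code takes
at the output. -/
structure IsCodeChange (B : Branching n J ι) {E : Type*} (P : Procedure B.Qubit E) (s : ℕ)
    (anc : B.Anc ↪ E) (out : Pauli n → Pauli B.Qubit) : Prop where
  time_lt : ∀ e, P.time e < P.rounds
  pos : 0 < s
  lt : s < P.rounds
  present_old : ∀ t q, P.present t (.inl q)
  correlation : ∀ M, (∀ j, symp M (B.check j) = 0) → P.IsCorrelation (B.ancEvents anc M) (out M)
  /-- While there are new qubits, the correlation of `M` involves the extension of `M`. -/
  pullback : ∀ M, ∀ t ≤ P.rounds, P.pullback (B.ancEvents anc M) (out M) t = B.extend M ∨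
    P.pullback (B.ancEvents anc M) (out M) t = B.inclusion M ∧ ∀ e, ¬ P.present t (.inr e)
  /-- The correlation of a check begins and ends with products of checks of the outer rounds. -/
  check_initial : ∀ j,
    P.pullback (B.ancEvents anc (B.check j)) (out (B.check j)) 0 ∈ P.checkGroup 0
  check_final : ∀ j, out (B.check j) ∈ P.checkGroup (P.rounds - 1)
  /-- Up to products of checks of the outer rounds, each correlation is that of a logical operator. -/
  complete : ∀ D L, P.IsCorrelation D L → ∃ M, (∀ j, symp M (B.check j) = 0) ∧
    P.pullback D L 0 + P.pullback (B.ancEvents anc M) (out M) 0 ∈ P.checkGroup 0 ∧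
    L + out M ∈ P.checkGroup (P.rounds - 1)
  /-- On one side of the time `s`, all events respect the logical operators of the original code. -/
  old_side : ∀ M, (∀ j, symp M (B.check j) = 0) →
    (∀ e, P.time e < s → symp (B.inclusion M) (P.op e) = 0) ∨
    (∀ e, s ≤ P.time e → symp (B.inclusion M) (P.op e) = 0)
  /-- The same group of checks is measured in all rounds before the change, -/
  before : ∀ a < s, ∀ e, P.isCheck e → P.time e ≤ a → P.op e ∈ P.checkGroup a
  /-- and in all rounds after it. -/
  after : ∀ b, s ≤ b → b < P.rounds → ∀ e, P.isCheck e → b ≤ P.time e → P.op e ∈ P.checkGroup b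
  /-- Initialisations and readouts happen within any two rounds before and after the change. -/
  change : ∀ a b, a < s → s ≤ b → ∀ e, ¬ P.isCheck e → a ≤ P.time e ∧ P.time e ≤ b

/-- Wrong signs `f` of initialisations or readouts of the new qubits, as errors `copyL` on them. -/
def signError (B : Branching n J ι) (f : B.Anc → ZMod 2) : Pauli B.Qubit
  | .inl _ => 0
  | .inr e => f e • B.copyL

/-- The product of all errors of a fault, a wrong sign of an initialisation or readout being counted
as the error `copyL` on the qubit concerned. Wrong check measurements do not contribute. -/
def totalError (B : Branching n J ι) {E : Type*} (P : Procedure B.Qubit E) (anc : B.Anc ↪ E)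
    (F : Fault B.Qubit E) : Pauli B.Qubit :=
  ∑ t ∈ range P.rounds, F.space t + B.signError (F.flip ∘ anc)

theorem hammingNorm_inclusion (B : Branching n J ι) (M : Pauli n) :
    hammingNorm (B.inclusion M) = hammingNorm M := by
  classical
  refine (card_bij (fun q _ => Sum.inl q) (fun q hq => ?_) (fun q _ q' _ h => Sum.inl_injective h)
    fun x hx => ?_).symm
  · exact mem_filter.2 ⟨mem_univ _, (mem_filter.1 hq).2⟩
  · rcases x with q | e
    · exact ⟨q, mem_filter.2 ⟨mem_univ _, (mem_filter.1 hx).2⟩, rfl⟩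
    · exact absurd rfl (mem_filter.1 hx).2

theorem hammingNorm_signError_le (B : Branching n J ι) {E : Type*} [Fintype E] (anc : B.Anc ↪ E)
    (f : E → ZMod 2) : hammingNorm (B.signError (f ∘ anc)) ≤ hammingNorm f := by
  classical
  have hsub : (univ.filter fun x => B.signError (f ∘ anc) x ≠ 0) ⊆
      (univ.filter fun e => f (anc e) ≠ 0).map Function.Embedding.inr := by
    intro x hx
    have hx' := (mem_filter.1 hx).2
    rcases x with q | e
    · exact absurd rfl hx'
    · refine mem_map.2 ⟨e, mem_filter.2 ⟨mem_univ _, fun h0 => hx' ?_⟩, rfl⟩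
      change f (anc e) • B.copyL = 0
      rw [h0, zero_smul]
  refine (card_le_card hsub).trans ?_
  rw [card_map, ← card_map anc]
  refine card_le_card fun x hx => ?_
  obtain ⟨e, he, rfl⟩ := mem_map.1 hx
  exact mem_filter.2 ⟨mem_univ _, (mem_filter.1 he).2⟩

theorem symp_signError_extend {B : Branching n J ι} (f : B.Anc → ZMod 2) (M : Pauli n) :
    symp (B.signError f) (B.extend M) =
      ∑ e with B.extend M (.inr e) ≠ 0, f e := by
  have hold : ∀ q, Letter.symp (B.signError f (.inl q)) (B.extend M (.inl q)) = 0 :=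
    fun q => Letter.zero_symp _
  rw [symp, Fintype.sum_sum_type, sum_eq_zero fun q _ => hold q, zero_add, sum_filter]
  refine sum_congr rfl fun e _ => ?_
  obtain ⟨c, hc⟩ := isTrans_extend (B := B) M e
  have hT : B.transL ≠ 0 := fun h0 => by
    have := trans_copy (B := B)
    rw [h0, Letter.zero_symp] at this
    exact zero_ne_one this
  change Letter.symp (f e • B.copyL) _ = _
  rw [hc, Letter.symp_smul, Letter.symp_comm, Letter.symp_smul, trans_copy, mul_one]
  have h01 : ∀ c : ZMod 2, c = 0 ∨ c = 1 := by decide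
  obtain rfl | rfl := h01 c
  · simp
  · simp [hT]

theorem hammingNorm_totalError_le (B : Branching n J ι) {E : Type*} [Fintype E]
    (P : Procedure B.Qubit E) (anc : B.Anc ↪ E) (F : Fault B.Qubit E) :
    hammingNorm (B.totalError P anc F) ≤ P.weight F :=
  (hammingNorm_add_le _ _).trans
    (add_le_add (hammingNorm_sum_le _ _) (hammingNorm_signError_le B anc F.flip))

namespace IsCodeChange

variable {E : Type*} {P : Procedure B.Qubit E} {s : ℕ}
  {anc : B.Anc ↪ E} {out : Pauli n → Pauli B.Qubit}

/-- The canonical correlation of a logical operator sees only the total error. -/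
theorem inversion_ancEvents (h : B.IsCodeChange P s anc out) {F : Fault B.Qubit E}
    (hF : P.IsFault F) (M : Pauli n) :
    P.inversion (B.ancEvents anc M) (out M) F = symp (B.totalError P anc F) (B.extend M) := by
  classical
  have hspace : ∀ t ∈ range P.rounds, symp (F.space t) (P.pullback (B.ancEvents anc M) (out M) t) =
      symp (F.space t) (B.extend M) := by
    intro t ht
    rcases h.pullback M t (mem_range.1 ht).le with h' | ⟨h', hp⟩
    · rw [h']
    · rw [h']
      refine sum_congr rfl fun x _ => ?_
      rcases x with q | e
      · rfl
      · have : F.space t (.inr e) = 0 := by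
          by_contra hne
          exact hp e (hF t _ hne).2.2
        rw [this, Letter.zero_symp, Letter.zero_symp]
  rw [Procedure.inversion, sum_congr rfl hspace, totalError, symp_add_left, symp_sum_left,
    symp_signError_extend, ancEvents, sum_map, add_comm]
  simp only [Function.comp_apply]

theorem two_le_rounds (h : B.IsCodeChange P s anc out) : 2 ≤ P.rounds := by
  have := h.pos
  have := h.lt
  omega

/-- With perfect initial and final rounds, undetected faults of weight less than the distance of
the original code are trivial. -/
theorem isStabiliser [Fintype E] (h : B.IsCodeChange P s anc out) {d : ℕ}
    (hd : IsCodeDistance B.check d) {F : Fault B.Qubit E} (hF : P.IsFault F)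
    (h0 : P.PerfectRound F 0) (h1 : P.PerfectRound F (P.rounds - 1)) (hu : P.IsUndetected F)
    (hw : P.weight F < d) : P.IsStabiliser F := by
  classical
  have hlogical : ∀ M, (∀ j, symp M (B.check j) = 0) →
      P.inversion (B.ancEvents anc M) (out M) F = 0 := by
    intro M hM
    rw [h.inversion_ancEvents hF]
    refine symp_extend_eq_zero hd ((hammingNorm_totalError_le B P anc F).trans_lt hw)
      (fun j => ?_) hM
    rw [← h.inversion_ancEvents hF]
    exact (h.correlation _ fun i => B.check_comm j i).inversion_eq_zero h.two_le_rounds h.time_lt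
      hF h0 h1 hu (h.check_initial j) (h.check_final j)
  intro D L hc
  obtain ⟨M, hM, hin, hout⟩ := h.complete D L hc
  rw [← P.pullback_symmDiff] at hin
  have key := (hc.symmDiff (h.correlation M hM)).inversion_eq_zero h.two_le_rounds h.time_lt
      hF h0 h1 hu hin hout
  rwa [P.inversion_symmDiff, hlogical M hM, add_zero] at key

/-- The fault-distance of a change of code is the distance of the original code. -/
theorem isFaultDistance [Fintype E] (h : B.IsCodeChange P s anc out) {d : ℕ}
    (hd : IsCodeDistance B.check d) : P.IsFaultDistance d := by
  classical
  constructor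
  · -- A logical operator of minimal weight, as an error at the time of the change of code.
    obtain ⟨L, ⟨hL, hL'⟩, hLd⟩ := hd.1
    let F : Fault B.Qubit E := ⟨fun t => if t = s then B.inclusion L else 0, 0⟩
    have hF : P.IsFault F := by
      intro t q hq
      by_cases ht : t = s
      · refine ⟨ht ▸ h.pos, ht ▸ h.lt, ?_⟩
        rcases q with q | e
        · exact h.present_old t q
        · simp only [F, if_pos ht] at hq
          exact absurd rfl hq
      · simp [F, ht] at hq
    refine ⟨F, ⟨hF, fun _ _ _ => rfl, fun _ _ _ => rfl, fun D hD => ?_, fun hst => ?_⟩, ?_⟩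
    · have hinv : P.inversion D 0 F = symp (B.inclusion L) (P.pullback D 0 s) := by
        have hflip : ∑ e ∈ D, F.flip e = 0 := sum_eq_zero fun _ _ => rfl
        rw [Procedure.inversion, hflip, zero_add,
          sum_eq_single s, show F.space s = B.inclusion L from if_pos rfl]
        · intro t _ ht
          simp [F, ht]
        · intro hs
          exact absurd (mem_range.2 h.lt) hs
      rw [hinv]
      rcases h.old_side L hL with hold | hold
      · have hsplit : P.pullback D 0 s = ∑ e ∈ D with ¬ s ≤ P.time e, P.op e := by
          have hD0 := hD.2
          simp only [Procedure.pullback, zero_add, Nat.zero_le, filter_true] at hD0 ⊢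
          rw [← sum_filter_add_sum_filter_not D (fun e => s ≤ P.time e)] at hD0
          rw [← add_zero (∑ e ∈ D with s ≤ P.time e, P.op e),
            ← ZModModule.add_self (∑ e ∈ D with ¬ s ≤ P.time e, P.op e), ← add_assoc, hD0, zero_add]
        rw [hsplit, symp_sum_right]
        exact sum_eq_zero fun e he => hold e (not_le.1 (mem_filter.1 he).2)
      · rw [Procedure.pullback, zero_add, symp_sum_right]
        exact sum_eq_zero fun e he => hold e (mem_filter.1 he).2
    · obtain ⟨M, hM, hLM⟩ := exists_symp_eq_one_of_notMem_span hL'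
      have hinv := hst _ _ (h.correlation M hM)
      have htot : B.totalError P anc F = B.inclusion L := by
        rw [totalError, sum_ite_eq' (range P.rounds) s, if_pos (mem_range.2 h.lt)]
        refine add_eq_left.2 ?_
        funext x
        rcases x with q | e
        exacts [rfl, zero_smul _ _]
      rw [h.inversion_ancEvents hF, htot,
        symp_of_isTrans (isTrans_inclusion L) (isTrans_extend M), restrict_inclusion,
        restrict_extend, hLM] at hinv
      exact one_ne_zero hinv
    · rw [Procedure.weight, sum_eq_single s]
      · simp only [F, if_true, hammingNorm_zero, add_zero, hammingNorm_inclusion]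
        exact hLd
      · intro t _ ht
        simp [F, ht]
      · intro hs
        exact absurd (mem_range.2 h.lt) hs
  · rintro _ ⟨F, ⟨hF, h0, h1, hu, hst⟩, rfl⟩
    by_contra hw
    exact hst (h.isStabiliser hd hF h0 h1 hu (not_le.1 hw))

/-- With at least `d` rounds on each side, each side has a round without wrong check measurement, and
the part of the fault between two such rounds is an undetected fault for which the outer rounds
are perfect. -/
theorem toleratesPadded [Fintype E] (h : B.IsCodeChange P s anc out) {d : ℕ}
    (hd : IsCodeDistance B.check d) (hs : d ≤ s) (hs' : s + d ≤ P.rounds) :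
    P.ToleratesPadded s d := by
  intro F hF hu hw
  obtain ⟨a, ha, hPa⟩ := Procedure.exists_perfectRound (P := P) (F := F) (S := range s)
    (by rw [card_range]; omega)
  obtain ⟨b, hb, hPb⟩ := Procedure.exists_perfectRound (P := P) (F := F) (S := Ico s P.rounds)
    (by rw [Nat.card_Ico]; omega)
  rw [mem_range] at ha
  rw [mem_Ico] at hb
  refine ⟨a, b, ha, hb.1, hb.2, hPa, hPb, ?_⟩
  refine h.isStabiliser hd (fun t q hq => hF t q fun h0 => hq ?_) (fun e he ht => ?_)
    (fun e he ht => ?_) (hu.window (by omega) hPa hPb (h.before a ha) (h.after b hb.1 hb.2)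
      (h.change a b ha hb.1)) ((P.weight_window_le F a b).trans_lt hw)
  · simp only [Procedure.window]
    split_ifs
    exacts [h0, rfl]
  · exact if_neg fun h' => by have := h' he; omega
  · exact if_neg fun h' => by have := h' he; omega

end IsCodeChange

/-! ### Branching and un-branching are changes of code -/

theorem symp_oldOp (O : Pauli B.Qubit) (j : J) :
    symp O (B.oldOp j) = symp (B.restrict O) (B.check j) := by
  have hanc : ∀ e, Letter.symp (O (.inr e)) (B.oldOp j (.inr e)) = 0 := fun e => Letter.symp_zero _
  rw [symp, Fintype.sum_sum_type, sum_eq_zero (s := (univ : Finset B.Anc)) fun e _ => hanc e,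
    add_zero]
  rfl

theorem symp_oldOp_oldOp (i j : J) : symp (B.oldOp i) (B.oldOp j) = 0 :=
  (symp_oldOp _ j).trans (B.check_comm i j)

theorem symp_ancOp_oldOp (e : B.Anc) (j : J) : symp (B.ancOp e) (B.oldOp j) = 0 :=
  (symp_oldOp _ j).trans (symp_zero_left _)

theorem inclusion_check (j : J) : B.inclusion (B.check j) = B.oldOp j := by
  funext x
  rcases x with q | e <;> rfl

theorem inclusion_restrict {O : Pauli B.Qubit} (h : ∀ e, O (.inr e) = 0) :
    B.inclusion (B.restrict O) = O := by
  funext x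
  rcases x with q | e
  exacts [rfl, (h e).symm]

/-- A product of operators of the procedures is a product of checks of the branched code, if it
commutes with the vertex checks: its factors that are checks of the branched code commute with
them, hence the product of the others does. -/
theorem sum_mem_span_newOp {K : Type*} {D : Finset K} {O : K → Pauli B.Qubit}
    (hO : ∀ e ∈ D, O e ∈ Set.range B.newOp ∨ O e ∈ Set.range B.oldOp ∨ O e ∈ Set.range B.ancOp)
    (hv : ∀ v, symp (∑ e ∈ D, O e) (B.vertexOp v) = 0) :
    ∑ e ∈ D, O e ∈ Submodule.span (ZMod 2) (Set.range B.newOp) := by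
  classical
  rw [← sum_filter_add_sum_filter_not D (fun e => O e ∈ Set.range B.newOp)] at hv ⊢
  have hnew : ∀ e ∈ D.filter fun e => O e ∈ Set.range B.newOp, O e ∈ Set.range B.newOp :=
    fun e he => (mem_filter.1 he).2
  have hold : ∀ e ∈ D.filter fun e => O e ∉ Set.range B.newOp,
      O e ∈ Set.range B.oldOp ∨ O e ∈ Set.range B.ancOp :=
    fun e he => (hO e (mem_filter.1 he).1).resolve_left (mem_filter.1 he).2
  refine Submodule.add_mem _
    (Submodule.sum_mem _ fun e he => Submodule.subset_span (hnew e he)) (mem_span_newOp ?_ ?_ ?_)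
  · refine IsTrans.sum fun e he => ?_
    rcases hold e he with ⟨j, hj⟩ | ⟨a, ha⟩
    exacts [hj ▸ isTrans_oldOp j, ha ▸ isTrans_ancOp a]
  · rw [restrict_sum]
    refine Submodule.sum_mem _ fun e he => ?_
    rcases hold e he with ⟨j, hj⟩ | ⟨a, ha⟩
    · rw [← hj, restrict_oldOp]
      exact Submodule.subset_span ⟨j, rfl⟩
    · rw [← ha, restrict_ancOp]
      exact Submodule.zero_mem _
  · intro v
    have h := hv v
    rwa [symp_add_left, symp_sum_left, sum_eq_zero fun e he => ?_, zero_add] at h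
    obtain ⟨k, hk⟩ := hnew e he
    rw [← hk, symp_newOp_vertexOp]

theorem sum_ancEvents {E : Type*} {anc : B.Anc ↪ E} {O : E → Pauli B.Qubit}
    (hO : ∀ e, O (anc e) = B.ancOp e) (M : Pauli n) :
    ∑ e ∈ B.ancEvents anc M, O e = B.extend M + B.inclusion M := by
  classical
  rw [ancEvents, sum_map, sum_congr rfl fun e _ => hO e]
  funext x
  rw [Finset.sum_apply]
  rcases x with q | e
  · have h0 : ∀ e, B.ancOp e (.inl q) = 0 := fun _ => rfl
    rw [sum_eq_zero fun e _ => h0 e]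
    exact (ZModModule.add_self (M q)).symm
  · have h1 : ∀ e', B.ancOp e' (.inr e) = if e = e' then B.transL else 0 := fun _ => rfl
    rw [sum_congr rfl fun e' _ => h1 e', sum_ite_eq]
    change _ = B.extend M (.inr e) + 0
    obtain ⟨c, hc⟩ := isTrans_extend (B := B) M e
    have h01 : ∀ c : ZMod 2, c = 0 ∨ c = 1 := by decide
    rw [add_zero]
    split_ifs with he
    · obtain rfl | rfl := h01 c
      · exact absurd (hc.trans (zero_smul _ _)) (mem_filter.1 he).2
      · rw [hc, one_smul]
    · by_contra h
      exact he (mem_filter.2 ⟨mem_univ _, fun h0 => h h0.symm⟩)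

theorem pullback_ancEvents {E : Type*} {P : Procedure B.Qubit E} {anc : B.Anc ↪ E} {k : ℕ}
    (hk : ∀ e, P.time (anc e) = k) (hop : ∀ e, P.op (anc e) = B.ancOp e) (M : Pauli n)
    (L : Pauli B.Qubit) (t : ℕ) :
    P.pullback (B.ancEvents anc M) L t =
      L + if t ≤ k then B.extend M + B.inclusion M else 0 := by
  rw [P.pullback_eq_add, Procedure.pullback_of_time_eq (k := k), sum_ancEvents hop]
  intro e he
  obtain ⟨a, _, rfl⟩ := mem_map.1 he
  exact hk a

theorem add_extend_add_inclusion (M : Pauli n) :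
    B.extend M + (B.extend M + B.inclusion M) = B.inclusion M := by
  rw [← add_assoc, ZModModule.add_self, zero_add]

theorem inclusion_add_extend_add (M : Pauli n) :
    B.inclusion M + (B.extend M + B.inclusion M) = B.extend M := by
  rw [add_comm, add_assoc, ZModModule.add_self, add_zero]

section Procedures

variable (B)

/-- The initialisations in branching. -/
def initEvent (p r : ℕ) : B.Anc ↪ (Fin p × J) ⊕ B.Anc ⊕ (Fin r × B.NewCheck) :=
  ⟨fun e => .inr (.inl e), fun _ _ h => Sum.inl_injective (Sum.inr_injective h)⟩

/-- The readouts in un-branching. -/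
def readoutEvent (r m : ℕ) : B.Anc ↪ (Fin r × B.NewCheck) ⊕ B.Anc ⊕ (Fin m × J) :=
  ⟨fun e => .inr (.inl e), fun _ _ h => Sum.inl_injective (Sum.inr_injective h)⟩

theorem pullback_initEvent {p r : ℕ} (hp : 1 ≤ p) (M : Pauli n) (t : ℕ) :
    (B.branchProcedure p r).pullback (B.ancEvents (B.initEvent p r) M) (B.extend M) t =
      if t < p then B.inclusion M else B.extend M := by
  rw [pullback_ancEvents (k := p - 1) (fun _ => rfl) (fun _ => rfl)]
  by_cases h : t < p
  · rw [if_pos h, if_pos (by omega), add_extend_add_inclusion]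
  · rw [if_neg h, if_neg (by omega), add_zero]

theorem pullback_readoutEvent {r m : ℕ} (M : Pauli n) (t : ℕ) :
    (B.unbranchProcedure r m).pullback (B.ancEvents (B.readoutEvent r m) M) (B.inclusion M) t =
      if t ≤ r then B.extend M else B.inclusion M := by
  rw [pullback_ancEvents (k := r) (fun _ => rfl) (fun _ => rfl)]
  split_ifs
  · rw [inclusion_add_extend_add]
  · rw [add_zero]

variable {B}

theorem branch_newOp_mem {p r k : ℕ} (hk : k < r) (c : B.NewCheck) :
    B.newOp c ∈ (B.branchProcedure p r).checkGroup (p + k) :=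
  Submodule.subset_span ⟨.inr (.inr (⟨k, hk⟩, c)), ⟨trivial, rfl⟩, rfl⟩

theorem branch_oldOp_mem {p r k : ℕ} (hk : k < p) (j : J) :
    B.oldOp j ∈ (B.branchProcedure p r).checkGroup k :=
  Submodule.subset_span ⟨.inl (⟨k, hk⟩, j), ⟨trivial, rfl⟩, rfl⟩

theorem unbranch_newOp_mem {r m k : ℕ} (hk : k < r) (c : B.NewCheck) :
    B.newOp c ∈ (B.unbranchProcedure r m).checkGroup k :=
  Submodule.subset_span ⟨.inl (⟨k, hk⟩, c), ⟨trivial, rfl⟩, rfl⟩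

theorem unbranch_oldOp_mem {r m k : ℕ} (hk : k < m) (j : J) :
    B.oldOp j ∈ (B.unbranchProcedure r m).checkGroup (r + k) :=
  Submodule.subset_span ⟨.inr (.inr (⟨k, hk⟩, j)), ⟨trivial, rfl⟩, rfl⟩

theorem isCodeChange_branchProcedure (B : Branching n J ι) {p r : ℕ} (hp : 1 ≤ p) (hr : 1 ≤ r) :
    B.IsCodeChange (B.branchProcedure p r) p (B.initEvent p r) B.extend := by
  have hT : (B.branchProcedure p r).rounds = p + r := rfl
  have htime : ∀ e, (B.branchProcedure p r).time e < p + r := by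
    rintro (⟨k, j⟩ | e | ⟨k, c⟩)
    · exact k.2.trans_le (Nat.le_add_right _ _)
    · change p - 1 < p + r
      omega
    · exact Nat.add_lt_add_left k.2 p
  have hspan : Submodule.span (ZMod 2) (Set.range B.newOp) ≤
      (B.branchProcedure p r).checkGroup (p + r - 1) := by
    have h := branch_newOp_mem (B := B) (p := p) (r := r) (k := r - 1) (by omega)
    rw [← Nat.add_sub_assoc hr] at h
    exact Submodule.span_le.2 (Set.range_subset_iff.2 h)
  have hcorr : ∀ M, (∀ j, symp M (B.check j) = 0) → (B.branchProcedure p r).IsCorrelation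
      (B.ancEvents (B.initEvent p r) M) (B.extend M) := by
    intro M hM
    constructor
    · intro e
      rw [B.pullback_initEvent hp]
      rcases e with ⟨k, j⟩ | e | ⟨k, c⟩
      · refine (symp_oldOp _ j).trans ?_
        split_ifs
        exacts [hM j, hM j]
      · refine symp_isTrans_ancOp ?_ e
        split_ifs
        exacts [isTrans_inclusion M, isTrans_extend M]
      · rw [if_neg (by change ¬ p + k + 1 < p; omega)]
        exact symp_extend_newOp hM c
    · intro t _ q hq
      rw [B.pullback_initEvent hp]
      rcases q with q | e
      · exact absurd trivial hq
      · rw [if_pos (not_le.1 hq)]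
        rfl
  refine ⟨htime, hp, Nat.lt_add_of_pos_right hr, fun _ _ => trivial, hcorr, fun M t _ => ?_, fun j => ?_,
    fun j => ?_, fun D L hc => ?_, fun M hM => Or.inl ?_, ?_, ?_, ?_⟩
  · rw [B.pullback_initEvent hp]
    split_ifs with h
    exacts [Or.inr ⟨rfl, fun e h' => absurd h (not_lt.2 h')⟩, Or.inl rfl]
  · rw [B.pullback_initEvent hp, if_pos (by omega), inclusion_check]
    exact branch_oldOp_mem hp j
  · exact hspan (extend_check_mem_span j)
  · classical
    have hfirst : ∀ e, (B.branchProcedure p r).time e = 0 → (∃ j, (B.branchProcedure p r).op e =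
        B.oldOp j) ∨ ∃ a, (B.branchProcedure p r).op e = B.ancOp a := by
      rintro (⟨k, j⟩ | a | ⟨k, c⟩) h
      · exact Or.inl ⟨j, rfl⟩
      · exact Or.inr ⟨a, rfl⟩
      · have : p + k = 0 := h
        omega
    -- The logical operator is read off at the input, where the new qubits are absent.
    set N := (B.branchProcedure p r).pullback D L 0 with hN
    have hN1 : N = (B.branchProcedure p r).pullback D L 1 +
        ∑ e ∈ D with (B.branchProcedure p r).time e = 0, (B.branchProcedure p r).op e := by
      rw [hN, Procedure.pullback, Procedure.pullback, add_assoc]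
      simp only [Nat.zero_le, filter_true]
      rw [← sum_filter_add_sum_filter_not D (fun e => 1 ≤ (B.branchProcedure p r).time e)]
      simp only [Nat.one_le_iff_ne_zero, not_not]
    have hM : ∀ j, symp (B.restrict N) (B.check j) = 0 := by
      intro j
      rw [← symp_oldOp, hN1, symp_add_left, symp_sum_left,
        sum_eq_zero fun e he => ?_, add_zero]
      · exact hc.1 (.inl (⟨0, hp⟩, j))
      · rcases hfirst e (mem_filter.1 he).2 with ⟨i, hi⟩ | ⟨a, ha⟩
        · rw [hi, symp_oldOp_oldOp]
        · rw [ha, symp_ancOp_oldOp]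
    have hN0 : B.inclusion (B.restrict N) = N :=
      inclusion_restrict fun e => hc.2 0 (Nat.zero_le _) _ (by change ¬ p ≤ 0; omega)
    have hsum : N + (B.branchProcedure p r).pullback (B.ancEvents (B.initEvent p r)
        (B.restrict N)) (B.extend (B.restrict N)) 0 = 0 := by
      rw [B.pullback_initEvent hp, if_pos (by omega), hN0, ZModModule.add_self]
    refine ⟨B.restrict N, hM, hsum ▸ Submodule.zero_mem _, ?_⟩
    have hc' := hc.symmDiff (hcorr _ hM)
    rw [hN, ← Procedure.pullback_symmDiff, ← hN] at hsum
    generalize symmDiff D (B.ancEvents (B.initEvent p r) (B.restrict N)) = D' at hc' hsum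
    generalize L + B.extend (B.restrict N) = L' at hc' hsum
    have hL' : L' = ∑ e ∈ D', (B.branchProcedure p r).op e := by
      rw [Procedure.pullback] at hsum
      simp only [Nat.zero_le, filter_true] at hsum
      rw [← add_zero L', ← ZModModule.add_self (∑ e ∈ D', (B.branchProcedure p r).op e),
        ← add_assoc, hsum, zero_add]
    refine hspan ?_
    rw [hL']
    refine sum_mem_span_newOp (fun e _ => ?_) fun v => ?_
    · rcases e with ⟨k, j⟩ | a | ⟨k, c⟩
      exacts [Or.inr (Or.inl ⟨j, rfl⟩), Or.inr (Or.inr ⟨a, rfl⟩), Or.inl ⟨c, rfl⟩]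
    · rw [← hL']
      -- After the last round the correlation is reduced to the output operator.
      have h := hc'.1 (.inr (.inr (⟨r - 1, by omega⟩, .inr (.inl v))))
      rw [Procedure.pullback, filter_false_of_mem, sum_empty, add_zero] at h
      · exact h
      · intro e _
        have := htime e
        change ¬ p + (r - 1) + 1 ≤ _
        omega
  · rintro (⟨k, j⟩ | a | ⟨k, c⟩) h
    · exact (symp_oldOp _ j).trans (hM j)
    · exact symp_isTrans_ancOp (isTrans_inclusion M) a
    · have : p + k < p := h
      omega
  · rintro a ha (⟨k, j⟩ | e | ⟨k, c⟩) hch h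
    · exact branch_oldOp_mem ha j
    · exact hch.elim
    · have : p + k ≤ a := h
      omega
  · rintro b hb hbT (⟨k, j⟩ | e | ⟨k, c⟩) hch h
    · have : b ≤ k := h
      omega
    · exact hch.elim
    · obtain ⟨i, rfl⟩ := Nat.exists_eq_add_of_le hb
      exact branch_newOp_mem (by omega) c
  · rintro a b ha hb (⟨k, j⟩ | e | ⟨k, c⟩) hch
    · exact absurd trivial hch
    · change a ≤ p - 1 ∧ p - 1 ≤ b
      omega
    · exact absurd trivial hch

theorem isCodeChange_unbranchProcedure (B : Branching n J ι) {r m : ℕ} (hr : 1 ≤ r) (hm : 1 ≤ m) :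
    B.IsCodeChange (B.unbranchProcedure r m) r (B.readoutEvent r m) B.inclusion := by
  have hT : (B.unbranchProcedure r m).rounds = r + m := rfl
  have htime : ∀ e, (B.unbranchProcedure r m).time e < r + m := by
    rintro (⟨k, c⟩ | e | ⟨k, j⟩)
    · exact k.2.trans_le (Nat.le_add_right _ _)
    · change r < r + m
      omega
    · exact Nat.add_lt_add_left k.2 r
  have hspan : Submodule.span (ZMod 2) (Set.range B.newOp) ≤
      (B.unbranchProcedure r m).checkGroup 0 :=
    Submodule.span_le.2 (Set.range_subset_iff.2 (unbranch_newOp_mem hr))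
  have hcorr : ∀ M, (∀ j, symp M (B.check j) = 0) → (B.unbranchProcedure r m).IsCorrelation
      (B.ancEvents (B.readoutEvent r m) M) (B.inclusion M) := by
    intro M hM
    constructor
    · intro e
      rw [B.pullback_readoutEvent]
      rcases e with ⟨k, c⟩ | e | ⟨k, j⟩
      · rw [if_pos (by change (k : ℕ) + 1 ≤ r; omega)]
        exact symp_extend_newOp hM c
      · refine symp_isTrans_ancOp ?_ e
        split_ifs
        exacts [isTrans_extend M, isTrans_inclusion M]
      · refine (symp_oldOp _ j).trans ?_
        split_ifs
        exacts [hM j, hM j]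
    · intro t _ q hq
      rw [B.pullback_readoutEvent]
      rcases q with q | e
      · exact absurd trivial hq
      · have hq' : ¬ t ≤ r := hq
        rw [if_neg hq']
        rfl
  refine ⟨htime, hr, by omega, fun _ _ => trivial, hcorr, fun M t _ => ?_, fun j => ?_,
    fun j => ?_, fun D L hc => ?_, fun M hM => Or.inr ?_, ?_, ?_, ?_⟩
  · rw [B.pullback_readoutEvent]
    split_ifs with h
    exacts [Or.inl rfl, Or.inr ⟨rfl, fun e h' => absurd h' h⟩]
  · rw [B.pullback_readoutEvent, if_pos (Nat.zero_le _)]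
    exact hspan (extend_check_mem_span j)
  · rw [inclusion_check, hT, Nat.add_sub_assoc hm]
    exact unbranch_oldOp_mem (by omega) j
  · classical
    -- The logical operator is read off at the output, where the new qubits are absent.
    have hL0 : B.inclusion (B.restrict L) = L := by
      refine inclusion_restrict fun e => ?_
      have h := hc.2 (r + m) le_rfl (.inr e) (by change ¬ r + m ≤ r; omega)
      rwa [Procedure.pullback, filter_false_of_mem fun e _ => not_le.2 (htime e), sum_empty,
        add_zero] at h
    have hM : ∀ j, symp (B.restrict L) (B.check j) = 0 := by
      intro j
      have h := hc.1 (.inr (.inr (⟨m - 1, by omega⟩, j)))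
      rw [Procedure.pullback, filter_false_of_mem, sum_empty, add_zero] at h
      · exact (symp_oldOp L j).symm.trans h
      · intro e _
        have := htime e
        change ¬ r + (m - 1) + 1 ≤ _
        omega
    have hout : L + B.inclusion (B.restrict L) = 0 := by rw [hL0, ZModModule.add_self]
    refine ⟨B.restrict L, hM, ?_, hout ▸ Submodule.zero_mem _⟩
    have hc' := hc.symmDiff (hcorr _ hM)
    rw [← Procedure.pullback_symmDiff]
    rw [hout] at hc' ⊢
    generalize symmDiff D (B.ancEvents (B.readoutEvent r m) (B.restrict L)) = D' at hc' ⊢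
    have hsplit : ∑ e ∈ D', (B.unbranchProcedure r m).op e =
        (B.unbranchProcedure r m).pullback D' 0 1 +
        ∑ e ∈ D' with (B.unbranchProcedure r m).time e = 0, (B.unbranchProcedure r m).op e := by
      rw [Procedure.pullback, zero_add,
        ← sum_filter_add_sum_filter_not D' (fun e => 1 ≤ (B.unbranchProcedure r m).time e)]
      simp only [Nat.one_le_iff_ne_zero, not_not]
    rw [Procedure.pullback, zero_add]
    simp only [Nat.zero_le, filter_true]
    refine hspan (sum_mem_span_newOp (fun e _ => ?_) fun v => ?_)
    · rcases e with ⟨k, c⟩ | a | ⟨k, j⟩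
      exacts [Or.inl ⟨c, rfl⟩, Or.inr (Or.inr ⟨a, rfl⟩), Or.inr (Or.inl ⟨j, rfl⟩)]
    · rw [hsplit, symp_add_left, symp_sum_left, sum_eq_zero fun e he => ?_, add_zero]
      · exact hc'.1 (.inl (⟨0, hr⟩, .inr (.inl v)))
      · have he0 := (mem_filter.1 he).2
        rcases e with ⟨k, c⟩ | a | ⟨k, j⟩
        · exact symp_newOp_vertexOp c v
        · have : r = 0 := he0
          omega
        · have : r + k = 0 := he0
          omega
  · rintro (⟨k, c⟩ | a | ⟨k, j⟩) h
    · have : r ≤ k := h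
      omega
    · exact symp_isTrans_ancOp (isTrans_inclusion M) a
    · exact (symp_oldOp _ j).trans (hM j)
  · rintro a ha (⟨k, c⟩ | e | ⟨k, j⟩) hch h
    · exact unbranch_newOp_mem ha c
    · exact hch.elim
    · have : r + k ≤ a := h
      omega
  · rintro b hb hbT (⟨k, c⟩ | e | ⟨k, j⟩) hch h
    · have : b ≤ k := h
      omega
    · exact hch.elim
    · obtain ⟨i, rfl⟩ := Nat.exists_eq_add_of_le hb
      exact unbranch_oldOp_mem (by omega) j
  · rintro a b ha hb (⟨k, c⟩ | e | ⟨k, j⟩) hch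
    · exact absurd trivial hch
    · exact ⟨ha.le, hb⟩
    · exact absurd trivial hch

end Procedures

end Branching

end BruteBranch

theorem lemma2p3 {n J ι : Type*} [Fintype n] [Fintype J] [DecidableEq n] [DecidableEq J]
    (B : BruteBranch.Branching n J ι) (d : ℕ) (hd : BruteBranch.IsCodeDistance B.check d) :
    (∀ p r, 1 ≤ p → d ≤ r → (B.branchProcedure p r).IsFaultDistance d) ∧
    (∀ p r, d ≤ p → d ≤ r → (B.branchProcedure p r).ToleratesPadded p d) ∧
    (∀ r m, 1 ≤ r → 1 ≤ m → (B.unbranchProcedure r m).IsFaultDistance d) ∧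
    (∀ r m, d ≤ r → d ≤ m → (B.unbranchProcedure r m).ToleratesPadded r d) := by
  have h1 := hd.pos
  refine ⟨fun p r hp hr => ?_, fun p r hp hr => ?_, fun r m hr hm => ?_, fun r m hr hm => ?_⟩
  · exact (B.isCodeChange_branchProcedure hp (h1.trans hr)).isFaultDistance hd
  · exact (B.isCodeChange_branchProcedure (h1.trans hp) (h1.trans hr)).toleratesPadded hd hp
      (Nat.add_le_add_left hr p)
  · exact (B.isCodeChange_unbranchProcedure hr hm).isFaultDistance hd
  · exact (B.isCodeChange_unbranchProcedure (h1.trans hr) (h1.trans hm)).toleratesPadded hd hr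
      (Nat.add_le_add_left hm r)
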